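/- **Setting.** Let $n\ge 1$, let $p^Y$ be a probability distribution on $\{1,\dots,n\}$, let $\beta,\tau>0$, and for each $y\in\{1,\dots,n\}$ let $\mathcal N_y$ be a symmetric set of pairs of distinct states (the allowed transitions of $X$ when the measurement outcome is $y$). A feedback process consists of measurable transition rates $R_t^{X|y}(x,x')\ge 0$ (from $(x',y)$ to $(x,y)$), which vanish off $\mathcal N_y$ and satisfy $R_t^{X|y}(x,x')=0\iff R_t^{X|y}(x',x)=0$, and of joint distributions $p_t^{XY}$, $0\le t\le\tau$, with $p_0^{XY}(x,y)=\delta_{x,y}\,p^Y(y)$ that solve, in integrated form, the master equation $$\frac{d}{dt}p_t^{XY}(x,y)=\sum_{x'}J_t^{X|y}(x,x'),\qquad J_t^{X|y}(x,x')=j_t^{X|y}(x,x')-j_t^{X|y}(x',x),\qquad j_t^{X|y}(x,x')=R_t^{X|y}(x,x')\,p_t^{XY}(x',y).$$ Put $F_t^{X|y}(x,x')=\ln\frac{j_t^{X|y}(x,x')}{j_t^{X|y}(x',x)}$ and $\ln\frac{R_t^{X|y}(x,x')}{R_t^{X|y}(x',x)}=-\beta Q_t^{X|y}(x,x')$ (with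 $Q_t^{X|y}(x,x')=0$ where both rates vanish). All $j_t^{X|y}(x,x')$ and $Q_t^{X|y}(x,x')\,j_t^{X|y}(x,x')$ are assumed integrable over $[0,\tau]$. With the Shannon entropy $S(p)=-\sum p\ln p$ let $$Q_\tau^X=\int_0^\tau\sum_{x,x',y}Q_t^{X|y}(x,x')\,j_t^{X|y}(x,x')\,dt,\qquad \Sigma_\tau^X=S(p_\tau^X)-S(p_0^X)-\beta Q_\tau^X,$$ $$\Delta I=I_\tau-I_0,\quad I_t=S(p_t^X)+S(p_t^Y)-S(p_t^{XY}),\qquad \langle m\rangle_\tau=\frac1\tau\int_0^\tau\sum_y\sum_{x>x'}\frac{J_t^{X|y}(x,x')}{F_t^{X|y}(x,x')}\,dt,$$ where $J/F$ is extended continuously: it is the common value of the two fluxes if they are equal, and $0$ if exactly one of them vanishes. Let $p^Y_\downarrow(1)\ge\dots\ge p^Y_\downarrow(n)$ be the values of $p^Y$ in descending order. If $p^Y_\downarrow(1)\ge 1-\mathcal W$, put $\tilde p^Y_{\mathcal W}=p^Y_\downarrow$. Otherwise, for $0\le\mathcal W<1-p^Y_\downarrow(1)$, let $M_{\mathcal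 W}$ be the largest $m\in\{2,\dots,n\}$ with $\frac{\mathcal W-\sum_{i>m}p^Y_\downarrow(i)}{m-1}<p^Y_\downarrow(m)$, let $q_{\mathcal W}=\frac{\mathcal W-\sum_{i>M_{\mathcal W}}p^Y_\downarrow(i)}{M_{\mathcal W}-1}$, and put $\tilde p^Y_{\mathcal W}(1)=1-\mathcal W$, $\tilde p^Y_{\mathcal W}(i)=q_{\mathcal W}$ for $2\le i\le M_{\mathcal W}$, and $\tilde p^Y_{\mathcal W}(i)=p^Y_\downarrow(i)$ for $i>M_{\mathcal W}$. **Claims.** 1. The map $\mathcal W\mapsto S(\tilde p^Y_{\mathcal W})$ is strictly increasing on $[0,1-p^Y_\downarrow(1)]$, maps this interval bijectively onto $[0,S(p^Y)]$, and has the constant value $S(p^Y)$ for $\mathcal W\ge 1-p^Y_\downarrow(1)$. Let $\mathcal W^{\min}_{p^Y}:[0,S(p^Y)]\to[0,1-p^Y_\downarrow(1)]$ be its inverse. 2. For every feedback process, $|\Delta I|\in[0,S(p^Y)]$ and $$\Sigma_\tau^X\ \ge\ -|\Delta I|+\frac{\mathcal W^{\min}_{p^Y}(|\Delta I|)^2}{\tau\langle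 m\rangle_\tau},$$ where the last term is read as $0$ if $\langle m\rangle_\tau=0$. 3. Assume condition (C): for all $y$ and all $x\ne y$, the transition between $y$ and $x$ belongs to $\mathcal N_y$. Let $\sigma$ be any permutation such that $\sigma(y)$ is a rank of $y$ in a descending order of $p^Y$ (ties broken arbitrarily), let $0<I\le S(p^Y)$ and $\mathcal W=\mathcal W^{\min}_{p^Y}(I)$. Let $p_*(x,y)=p_*^X(x)\,p_*^{Y|x}(y)$ with $$p_*^X(x)=\begin{cases}\dfrac{p^Y(x)-q_{\mathcal W}}{1-\mathcal W-q_{\mathcal W}},&\sigma(x)\le M_{\mathcal W},\\[1ex]0,&\sigma(x)>M_{\mathcal W},\end{cases}\qquad p_*^{Y|x}(y)=\begin{cases}\tilde p^Y_{\mathcal W}(1),&y=x,\\ \tilde p^Y_{\mathcal W}(\sigma(x)),&y\ne x,\ \sigma(y)=1,\\ \tilde p^Y_{\mathcal W}(\sigma(y)),&\text{otherwise,}\end{cases}$$ except that in the endpoint case $\mathcal W=1-p^Y_\downarrow(1)$ the distribution $p_*^X$ is concentrated on the state of rank $1$. Call a feedback process optimal if $p_\tau^{XY}=p_*$ and the following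 two conditions hold. * It transports probability along an optimal transport plan. That is, there is a plan $\pi_{(x,y),(x',y)}\ge 0$ from $p_0^{XY}$ to $p_\tau^{XY}$ which has minimal cost, where the cost per unit probability is the least number of allowed transitions from $(x',y)$ to $(x,y)$, and $\int_0^\tau\max(J_t^{X|y}(x,x'),0)\,dt=\pi_{(x,y),(x',y)}$ for all $y$ and $x\ne x'$. * Its thermodynamic force is constant and uniform. That is, there is a constant $F$ such that $|F_t^{X|y}(x,x')|=F$ for almost every $t\in[0,\tau]$ whenever $j_t^{X|y}(x,x')\ne0$. Then every optimal process has $|\Delta I|=I$ and attains equality in claim 2, and for every $m>0$ there is an optimal process with $\langle m\rangle_\tau=m$. -/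

import Mathlib

open Set MeasureTheory
open scoped ENNReal

noncomputable section

namespace Feedback

/-- Shannon entropy `S(p) = -∑ p ln p` (with `0 ln 0 = 0`). -/
def entropy {ι : Type*} [Fintype ι] (p : ι → ℝ) : ℝ := ∑ i, Real.negMulLog (p i)

/-! ### The extremal distribution of the achievable Fano inequality

States are `Fin n`; the rank `r : Fin n` stands for the `(r+1)`-th largest value. -/

/-- `p↓`: the values of `p` in descending order; `pDown p 0` is the largest value. -/
def pDown {n : ℕ} (p : Fin n → ℝ) : Fin n → ℝ :=
  p ∘ Tuple.sort (fun i => OrderDual.toDual (p i))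

/-- `M_E`: the largest `m ∈ {2, …, n}` with
`(E - ∑_{i > m} p↓(i)) / (m - 1) < p↓(m)`; the `m`-th value of `p↓` is `pDown p k`, `k = m - 1`. -/
def fanoM {n : ℕ} (p : Fin n → ℝ) (E : ℝ) : ℕ :=
  sSup {m : ℕ | 2 ≤ m ∧ ∃ k : Fin n, (k : ℕ) + 1 = m ∧
    (E - ∑ i ∈ Finset.Ioi k, pDown p i) / ((m : ℝ) - 1) < pDown p k}

/-- The common value `(E - ∑_{i > M_E} p↓(i)) / (M_E - 1)` of the ranks `2, …, M_E`. -/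
def fanoLevel {n : ℕ} (p : Fin n → ℝ) (E : ℝ) : ℝ :=
  (E - ∑ i ∈ Finset.univ.filter (fun i : Fin n => fanoM p E ≤ (i : ℕ)), pDown p i) / ((fanoM p E : ℝ) - 1)

/-- The distribution `p̃_E`. -/
def fanoDist {n : ℕ} [NeZero n] (p : Fin n → ℝ) (E : ℝ) (r : Fin n) : ℝ :=
  if 1 - E ≤ pDown p 0 then pDown p r
  else if r = 0 then 1 - E
  else if (r : ℕ) + 1 ≤ fanoM p E then fanoLevel p E
  else pDown p r

/-- `W ↦ S(p̃_W)`. -/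
def fanoEntropy {n : ℕ} [NeZero n] (p : Fin n → ℝ) (W : ℝ) : ℝ := entropy (fanoDist p W)

/-- `W^min_p`: the inverse of `W ↦ S(p̃_W)` on `[0, 1 - p↓(1)]`. -/
def Wmin {n : ℕ} [NeZero n] (p : Fin n → ℝ) : ℝ → ℝ :=
  Function.invFunOn (fanoEntropy p) (Icc 0 (1 - pDown p 0))

/-! ### The optimal final distribution -/

/-- The `X`-marginal of the optimal final distribution. `σ y` is the rank of `y`. At the endpoint
`1 - W ≤ p↓(1)`, where `p̃_W = p↓`, all of the mass sits at the state of rank one. -/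
def optMarginal {n : ℕ} [NeZero n] (p : Fin n → ℝ) (σ : Equiv.Perm (Fin n)) (W : ℝ)
    (x : Fin n) : ℝ :=
  if 1 - W ≤ pDown p 0 then (if σ x = 0 then 1 else 0)
  else if (σ x : ℕ) + 1 ≤ fanoM p W then
    (p x - fanoLevel p W) / (fanoDist p W 0 - fanoLevel p W)
  else 0

/-- The conditional distribution of `Y` given `X = x`: `p̃_W` arranged by rank, with the values at
`y = x` and at the state of rank one swapped. -/
def optConditional {n : ℕ} [NeZero n] (p : Fin n → ℝ) (σ : Equiv.Perm (Fin n)) (W : ℝ)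
    (x y : Fin n) : ℝ :=
  if y = x then fanoDist p W 0
  else if σ y = 0 then fanoDist p W (σ x)
  else fanoDist p W (σ y)

/-- The optimal final joint distribution `(x, y) ↦ p^X(x) p^{Y|x}(y)`. -/
def optFinal {n : ℕ} [NeZero n] (p : Fin n → ℝ) (σ : Equiv.Perm (Fin n)) (W : ℝ)
    (x y : Fin n) : ℝ :=
  optMarginal p σ W x * optConditional p σ W x y

/-! ### Feedback processes

`R t y x x'` is the rate of `(x', y) → (x, y)` at time `t`, and `p t x y` the probability of
`(x, y)`. The graph `G y` on the states of `X` holds the allowed transitions for the outcome `y`. -/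

section Rates

variable {n : ℕ} (R : ℝ → Fin n → Fin n → Fin n → ℝ) (p : ℝ → Fin n → Fin n → ℝ)

/-- `j(x, x') = R(x, x') p(x', y)`: expected number of jumps `(x', y) → (x, y)` per unit time. -/
def flux (t : ℝ) (y x x' : Fin n) : ℝ := R t y x x' * p t x' y

/-- The net current `J(x, x') = j(x, x') - j(x', x)` from `(x', y)` to `(x, y)`. -/
def current (t : ℝ) (y x x' : Fin n) : ℝ := flux R p t y x x' - flux R p t y x' x

/-- The thermodynamic force `F(x, x') = ln (j(x, x') / j(x', x))`. -/
def force (t : ℝ) (y x x' : Fin n) : ℝ := Real.log (flux R p t y x x' / flux R p t y x' x)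

/-- The local mobility `J / F`, extended continuously to `J = F = 0` (by the common value of
`j(x, x')` and `j(x', x)`); it is `0` if one of the two fluxes is `0`. -/
def localMobility (t : ℝ) (y x x' : Fin n) : ℝ :=
  if current R p t y x x' = 0 then flux R p t y x x'
  else current R p t y x x' / force R p t y x x'

/-- The heat absorbed in a jump `(x', y) → (x, y)`, given by local detailed balance
`ln (R(x, x') / R(x', x)) = -β Q(x, x')`. -/
def heat (β : ℝ) (t : ℝ) (y x x' : Fin n) : ℝ :=
  -(1 / β) * Real.log (R t y x x' / R t y x' x)

end Rates

/-- A feedback process on `[0, τ]` after an error-free measurement with outcome distribution `pY`: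
time-dependent rates and the solution (in the integrated sense, so that rates may be switched and
may diverge at isolated times) of the master equation started at `δ_{x,y} pY(y)`. -/
structure FeedbackProcess {n : ℕ} (G : Fin n → SimpleGraph (Fin n)) (pY : Fin n → ℝ) (β τ : ℝ) where
  /-- the transition rates -/
  rate : ℝ → Fin n → Fin n → Fin n → ℝ
  /-- the joint distribution -/
  prob : ℝ → Fin n → Fin n → ℝ
  rate_measurable : ∀ y x x', Measurable fun t => rate t y x x'
  rate_nonneg : ∀ t y x x', 0 ≤ rate t y x x'
  /-- only transitions along the edges of `G y` occur -/
  rate_eq_zero : ∀ t y x x', ¬ (G y).Adj x' x → rate t y x x' = 0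
  /-- transitions are bidirectional -/
  rate_bidirectional : ∀ t y x x', rate t y x x' = 0 → rate t y x' x = 0
  prob_nonneg : ∀ t ∈ Icc 0 τ, ∀ x y, 0 ≤ prob t x y
  prob_zero : ∀ x y, prob 0 x y = if x = y then pY y else 0
  /-- the expected number of jumps along each transition is finite -/
  flux_integrable : ∀ y x x', IntervalIntegrable (fun t => flux rate prob t y x x') volume 0 τ
  /-- the master equation -/
  master : ∀ t ∈ Icc 0 τ, ∀ x y, prob t x y = prob 0 x y +
    ∫ s in (0 : ℝ)..t, ∑ x', (flux rate prob s y x x' - flux rate prob s y x' x)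
  /-- the expected heat exchanged along each transition is finite -/
  heat_integrable : ∀ y x x',
    IntervalIntegrable (fun t => heat rate β t y x x' * flux rate prob t y x x') volume 0 τ

namespace FeedbackProcess

variable {n : ℕ} {G : Fin n → SimpleGraph (Fin n)} {pY : Fin n → ℝ} {β τ : ℝ}
  (P : FeedbackProcess G pY β τ)

/-- The marginal distribution of `X`. -/
def probX (t : ℝ) (x : Fin n) : ℝ := ∑ y, P.prob t x y

/-- The marginal distribution of `Y`. -/
def probY (t : ℝ) (y : Fin n) : ℝ := ∑ x, P.prob t x y

/-- The mutual information `S(p^X) + S(p^Y) - S(p^{XY})`. -/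
def mutualInfo (t : ℝ) : ℝ :=
  entropy (P.probX t) + entropy (P.probY t)
    - entropy (fun z : Fin n × Fin n => P.prob t z.1 z.2)

/-- The change `ΔI` of the mutual information. -/
def deltaI : ℝ := P.mutualInfo τ - P.mutualInfo 0

/-- The total heat absorbed by `X`. -/
def totalHeat : ℝ :=
  ∫ t in (0 : ℝ)..τ, ∑ y, ∑ x, ∑ x', heat P.rate β t y x x' * flux P.rate P.prob t y x x'

/-- The entropy production of the subsystem `X`. -/
def entropyProductionX : ℝ := entropy (P.probX τ) - entropy (P.probX 0) - β * P.totalHeat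

/-- The time-averaged mobility. -/
def meanMobility : ℝ :=
  (1 / τ) * ∫ t in (0 : ℝ)..τ,
    ∑ y, ∑ x, ∑ x' ∈ Finset.Iio x, localMobility P.rate P.prob t y x x'

/-- Constant uniform thermodynamic force of magnitude `F`: at almost every time, the force on every
transition that is in use has magnitude `F`. -/
def HasConstantUniformForce (F : ℝ) : Prop :=
  ∀ᵐ t ∂(volume.restrict (Icc 0 τ)), ∀ y x x', flux P.rate P.prob t y x x' ≠ 0 →
    |force P.rate P.prob t y x x'| = F

/-- Probability is transported along the plan `π`: for `x' ≠ x`, the probability carried by the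
current through the direct transition `(x', y) → (x, y)` is the amount that `π` assigns to it. -/
def TransportsAlong (π : Fin n → Fin n → Fin n → ℝ) : Prop :=
  ∀ y x x', x ≠ x' →
    ∫ t in (0 : ℝ)..τ, max (current P.rate P.prob t y x x') 0 = π y x x'

end FeedbackProcess

/-! ### Optimal transport -/

/-- `π y x x'` is the probability transported from `(x', y)` to `(x, y)`. -/
structure IsTransportPlan {n : ℕ} (p q : Fin n → Fin n → ℝ) (π : Fin n → Fin n → Fin n → ℝ) :
    Prop where
  nonneg : ∀ y x x', 0 ≤ π y x x'
  source : ∀ y x', ∑ x, π y x x' = p x' y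
  target : ∀ y x, ∑ x', π y x x' = q x y

/-- The cost of a plan; the cost per unit probability is the least number of transitions from
`(x', y)` to `(x, y)` (infinite if there is no path). -/
def transportCost {n : ℕ} (G : Fin n → SimpleGraph (Fin n)) (π : Fin n → Fin n → Fin n → ℝ) :
    ℝ≥0∞ :=
  ∑ y, ∑ x, ∑ x', (((G y).edist x' x : ℕ∞) : ℝ≥0∞) * ENNReal.ofReal (π y x x')

/-- `π` has the least cost, the Wasserstein distance of `p` and `q`, among the plans from `p` to
`q`. -/
def IsOptimalPlan {n : ℕ} (G : Fin n → SimpleGraph (Fin n)) (p q : Fin n → Fin n → ℝ)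
    (π : Fin n → Fin n → Fin n → ℝ) : Prop :=
  IsTransportPlan p q π ∧ ∀ π', IsTransportPlan p q π' → transportCost G π ≤ transportCost G π'

/-- Condition (C): for every outcome `y`, the direct transition from `(y, y)` to any other `(x, y)`
is possible. -/
def ConditionC {n : ℕ} (G : Fin n → SimpleGraph (Fin n)) : Prop :=
  ∀ y x, x ≠ y → (G y).Adj y x

/-- The process ends in `q` and gets there along an optimal transport plan with constant uniform
thermodynamic force. -/
def FeedbackProcess.IsOptimalProtocolTo {n : ℕ} {G : Fin n → SimpleGraph (Fin n)} {pY : Fin n → ℝ}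
    {β τ : ℝ} (P : FeedbackProcess G pY β τ) (q : Fin n → Fin n → ℝ) : Prop :=
  P.prob τ = q ∧
  (∃ π, IsOptimalPlan G (P.prob 0) (P.prob τ) π ∧ P.TransportsAlong π) ∧
  ∃ F, P.HasConstantUniformForce F

end Feedback

end

/-! `Y` never changes and is initially a copy of `X`, so the mutual information starts at `S(pY)`
and `|ΔI|` is the conditional entropy `S(Y | X)` of the final distribution. The entropy production
of `X` is then `-|ΔI|` plus the total entropy production `Σ`, and the bound becomes `Σ ≥ W² /
(τ⟨m⟩)`. It has a static and a dynamic half, which meet in the error probability `E = 1 - ∑ p_τ(y,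
y)` of reading `Y` off `X`.

Static half: a sharp Fano inequality with the marginal of `Y` prescribed. The extremal distribution
is `pY` cut off at a level `q`, with the missing mass put at rank one, so `W` and `S(p̃_W)` are
continuous functions of `q`. Gibbs' inequality against a suitable conditional law bounds `S(Y | X)`
by an affine function of the error (`condEntropy_le_truncEntropy_add`). Equality holds for
`optFinal`, a mixture of permutations of the extremal distribution (`condEntropy_optFinal`). Strict
monotonicity of `W ↦ S(p̃_W)` follows by inserting the extremal distribution for one error into the
bound for a larger one; surjectivity is the intermediate value theorem in `q`. Hence `E ≥ Wmin |ΔI|`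
(`Wmin_condEntropy_le`).

Dynamic half: the net probability leaving the states `(y, y)` is `E`, so the time-integrated
absolute current is at least `E`. Pointwise `J² = m · (J F)` with `m` the local mobility, and `Σ` is
the integral of `J F` over unordered pairs (`dissipation`), so Cauchy–Schwarz gives `E² ≤ τ⟨m⟩ Σ`.
The formula for `Σ` is the delicate point: `ln p` is singular where `p` vanishes, as it does off the
diagonal at time `0`. The logarithms are therefore shifted by `ε`, and the limit is justified by `J
F ≥ 0`.

Equality: the initial distribution is diagonal, so there is only one transport plan, and following
it makes the integrated current exactly `E`. Constant force `F` gives `|J| = F m` and `J F = F |J|`,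
hence `E = F τ⟨m⟩` and `Σ = F E`. Under condition (C), a constant flow from each `(y, y)` straight
to the `(x, y)` realises this for every `F > 0`. -/

namespace Feedback

/-! ### Truncation at a level

The extremal distribution is `p` truncated at a level `q`, with the missing mass at rank one. -/

/-- The error probability of the extremal distribution with level `q`. -/
def truncErr {n : ℕ} (p : Fin n → ℝ) (q : ℝ) : ℝ := ∑ y, min (p y) q - q

/-- The entropy of the extremal distribution with level `q`. -/
noncomputable def truncEntropy {n : ℕ} (p : Fin n → ℝ) (q : ℝ) : ℝ :=
  Real.negMulLog (1 - truncErr p q) + ∑ y, Real.negMulLog (min (p y) q) - Real.negMulLog q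

section Truncation

variable {n : ℕ} {p : Fin n → ℝ} {q : ℝ}

theorem pDown_antitone (p : Fin n → ℝ) : Antitone (pDown p) :=
  fun _ _ h => Tuple.monotone_sort (fun i => OrderDual.toDual (p i)) h

theorem sum_comp_pDown (p : Fin n → ℝ) (f : ℝ → ℝ) : ∑ i, f (pDown p i) = ∑ i, f (p i) :=
  Equiv.sum_comp (Tuple.sort (fun i => OrderDual.toDual (p i))) (fun i => f (p i))

/-- All descending rearrangements of `p` coincide as functions, so the way `σ` breaks ties is
irrelevant. -/
theorem pDown_apply_of_antitone {σ : Equiv.Perm (Fin n)} (h : Antitone (p ∘ σ.symm)) (i : Fin n) :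
    pDown p (σ i) = p i := by
  have h1 : (fun i => OrderDual.toDual (p i)) ∘ σ.symm =
      (fun i => OrderDual.toDual (p i)) ∘ Tuple.sort (fun i => OrderDual.toDual (p i)) :=
    Tuple.comp_sort_eq_comp_iff_monotone.2 fun _ _ hij => h hij
  have h2 := congrFun h1 (σ i)
  simp only [Function.comp_apply, Equiv.symm_apply_apply] at h2
  exact (OrderDual.toDual.injective h2).symm

theorem exists_perm_antitone (p : Fin n → ℝ) : ∃ σ : Equiv.Perm (Fin n), Antitone (p ∘ σ.symm) :=
  ⟨(Tuple.sort (fun i => OrderDual.toDual (p i))).symm, pDown_antitone p⟩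

theorem continuous_truncErr (p : Fin n → ℝ) : Continuous (truncErr p) := by
  unfold truncErr
  fun_prop

theorem continuous_truncEntropy (p : Fin n → ℝ) : Continuous (truncEntropy p) := by
  have := continuous_truncErr p
  unfold truncEntropy
  fun_prop

theorem truncErr_zero (hp : ∀ y, 0 ≤ p y) : truncErr p 0 = 0 := by
  simp [truncErr, min_eq_right (hp _)]

theorem truncEntropy_zero (hp : ∀ y, 0 ≤ p y) : truncEntropy p 0 = 0 := by
  simp [truncEntropy, truncErr_zero hp, min_eq_right (hp _)]

variable [NeZero n]

theorem le_pDown_zero (p : Fin n → ℝ) (i : Fin n) : p i ≤ pDown p 0 := by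
  obtain ⟨σ, hσ⟩ := exists_perm_antitone p
  rw [← pDown_apply_of_antitone hσ i]
  exact pDown_antitone p (Fin.zero_le _)

theorem sum_comp_eq_pDown_zero_add (p : Fin n → ℝ) (f : ℝ → ℝ) :
    ∑ i, f (p i) = f (pDown p 0) + ∑ i ∈ Finset.univ.erase 0, f (pDown p i) := by
  rw [← sum_comp_pDown, Finset.add_sum_erase _ (fun i => f (pDown p i)) (Finset.mem_univ 0)]

theorem sum_erase_pDown (hp : ∑ y, p y = 1) :
    ∑ i ∈ Finset.univ.erase 0, pDown p i = 1 - pDown p 0 := by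
  have := sum_comp_eq_pDown_zero_add p (fun x => x)
  linarith

/-- Rank one is cut to `q` and cancels the subtracted `q`; what remains is the truncated mass of the
other ranks. -/
theorem truncErr_eq_sum_erase (hq : q ≤ pDown p 0) :
    truncErr p q = ∑ i ∈ Finset.univ.erase 0, min (pDown p i) q := by
  rw [truncErr, sum_comp_eq_pDown_zero_add p (fun x => min x q), min_eq_right hq]
  ring

theorem truncErr_le (hp : ∑ y, p y = 1) (hq : q ≤ pDown p 0) : truncErr p q ≤ 1 - pDown p 0 := by
  rw [truncErr_eq_sum_erase hq, ← sum_erase_pDown hp]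
  exact Finset.sum_le_sum fun i _ => min_le_left _ _

theorem truncErr_nonneg (hp : ∀ y, 0 ≤ p y) (hq0 : 0 ≤ q) (hq : q ≤ pDown p 0) :
    0 ≤ truncErr p q := by
  rw [truncErr_eq_sum_erase hq]
  refine Finset.sum_nonneg fun i _ => le_min ?_ hq0
  exact hp _

/-- Equality in `truncErr_le` leaves no room for the truncation to cut anything outside rank one. -/
theorem pDown_le_of_le_truncErr (hp : ∑ y, p y = 1) (hq : q ≤ pDown p 0)
    (h : 1 - pDown p 0 ≤ truncErr p q) {i : Fin n} (hi : i ≠ 0) : pDown p i ≤ q := by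
  rw [truncErr_eq_sum_erase hq, ← sum_erase_pDown hp] at h
  by_contra hlt
  refine absurd h (not_le.2 (Finset.sum_lt_sum (fun i _ => min_le_left _ _) ⟨i, by simp [hi], ?_⟩))
  exact min_lt_of_right_lt (not_le.1 hlt)

theorem truncErr_pDown_zero (hp : ∑ y, p y = 1) : truncErr p (pDown p 0) = 1 - pDown p 0 := by
  simp [truncErr, min_eq_left (le_pDown_zero p _), hp]

theorem exists_truncErr_eq (hp : p ∈ stdSimplex ℝ (Fin n)) {W : ℝ}
    (hW : W ∈ Icc 0 (1 - pDown p 0)) : ∃ q ∈ Icc 0 (pDown p 0), truncErr p q = W := by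
  have h0 : 0 ≤ pDown p 0 := hp.1 _
  refine intermediate_value_Icc h0 (continuous_truncErr p).continuousOn ?_
  rwa [truncErr_zero hp.1, truncErr_pDown_zero hp.2]

theorem sum_erase_zero_eq (f : Fin n → ℝ) (k : Fin n) :
    ∑ i ∈ Finset.univ.erase 0, f i = ∑ i ∈ Finset.Ioc 0 k, f i + ∑ i ∈ Finset.Ioi k, f i := by
  rw [← Finset.sum_union]
  · refine Finset.sum_congr ?_ fun _ _ => rfl
    ext i
    simp only [Finset.mem_erase, Finset.mem_univ, and_true, Finset.mem_union, Finset.mem_Ioc,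
      Finset.mem_Ioi, ← Fin.pos_iff_ne_zero]
    refine ⟨fun h => (le_or_gt i k).imp (fun h' => ⟨h, h'⟩) id, ?_⟩
    rintro (h | h)
    · exact h.1
    · exact lt_of_le_of_lt (Fin.zero_le _) h
  · refine Finset.disjoint_left.2 fun i hi hi' => ?_
    rw [Finset.mem_Ioc] at hi
    rw [Finset.mem_Ioi] at hi'
    exact absurd hi.2 (not_le.2 hi')

theorem card_Ioc_zero (k : Fin n) : (Finset.Ioc 0 k).card = (k : ℕ) := by
  simp [Fin.card_Ioc]

/-- With `E = truncErr p q`, the defining condition compares `E` minus the tail with `k · p↓(k)`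
(ranks counted from zero). If `q ≥ p↓(k)`, the tail is uncut and the `k` ranks in `(0, k]` each
contribute at least `p↓(k)`. If `q < p↓(k)`, they contribute at most `q` each and the truncated tail
is at most the tail. -/
theorem fanoM_condition_iff (hq : q ≤ pDown p 0) {k : Fin n} (hk : k ≠ 0) :
    (truncErr p q - ∑ i ∈ Finset.Ioi k, pDown p i) / ((((k : ℕ) + 1 : ℕ) : ℝ) - 1) < pDown p k ↔
      q < pDown p k := by
  have hk0 : (0 : ℝ) < (k : ℕ) := by
    exact_mod_cast Nat.pos_of_ne_zero fun h => hk (Fin.ext (by simpa using h))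
  rw [Nat.cast_add, Nat.cast_one, add_sub_cancel_right, div_lt_iff₀ hk0,
    truncErr_eq_sum_erase hq, sum_erase_zero_eq _ k]
  constructor
  · contrapose!
    intro h
    have h1 : ∑ i ∈ Finset.Ioi k, min (pDown p i) q = ∑ i ∈ Finset.Ioi k, pDown p i := by
      refine Finset.sum_congr rfl fun i hi => min_eq_left ?_
      exact (pDown_antitone p (Finset.mem_Ioi.1 hi).le).trans h
    have h2 := Finset.card_nsmul_le_sum (Finset.Ioc 0 k) (fun i => min (pDown p i) q) (pDown p k)
      fun i hi => le_min (pDown_antitone p (Finset.mem_Ioc.1 hi).2) h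
    rw [card_Ioc_zero, nsmul_eq_mul] at h2
    rw [h1]
    linarith
  · intro h
    have h1 : ∑ i ∈ Finset.Ioi k, min (pDown p i) q ≤ ∑ i ∈ Finset.Ioi k, pDown p i :=
      Finset.sum_le_sum fun i _ => min_le_left _ _
    have h2 := Finset.sum_le_card_nsmul (Finset.Ioc 0 k) (fun i => min (pDown p i) q) q
      fun i hi => min_le_right _ _
    rw [card_Ioc_zero, nsmul_eq_mul] at h2
    nlinarith

/-- By monotonicity the ranks with value above `q` form an initial segment, and `fanoM` is its
length. -/
theorem exists_fanoM_eq (hp : ∑ y, p y = 1) (hq : q ≤ pDown p 0)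
    (h : truncErr p q < 1 - pDown p 0) :
    ∃ k : Fin n, k ≠ 0 ∧ fanoM p (truncErr p q) = (k : ℕ) + 1 ∧ ∀ i, i ≤ k ↔ q < pDown p i := by
  set S : Set ℕ := {m : ℕ | 2 ≤ m ∧ ∃ k : Fin n, (k : ℕ) + 1 = m ∧
    (truncErr p q - ∑ i ∈ Finset.Ioi k, pDown p i) / ((m : ℝ) - 1) < pDown p k} with hS
  have hmem : ∀ k : Fin n, k ≠ 0 → q < pDown p k → (k : ℕ) + 1 ∈ S := by
    intro k hk hlt
    have hk0 : 0 < (k : ℕ) := Nat.pos_of_ne_zero fun h => hk (Fin.ext (by simpa using h))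
    exact ⟨by omega, k, rfl, (fanoM_condition_iff hq hk).2 hlt⟩
  have hbdd : BddAbove S := by
    refine ⟨n, ?_⟩
    rintro m ⟨-, k, rfl, -⟩
    exact k.2
  -- `sSup` on `ℕ` returns a member only for a nonempty bounded set. Were the set empty, nothing
  -- outside rank one would be cut, and the error would reach `1 - p↓(1)`.
  have hne : S.Nonempty := by
    by_contra hempty
    refine absurd h (not_lt.2 ?_)
    rw [truncErr_eq_sum_erase hq, ← sum_erase_pDown hp]
    refine Finset.sum_le_sum fun i hi => le_min le_rfl ?_
    by_contra hlt
    exact hempty ⟨_, hmem i (Finset.ne_of_mem_erase hi) (not_le.1 hlt)⟩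
  obtain ⟨h2, k, hk, hlt⟩ := Nat.sSup_mem hne hbdd
  have hk0 : k ≠ 0 := by
    rintro rfl
    simp only [Fin.val_zero] at hk
    omega
  rw [← hk, fanoM_condition_iff hq hk0] at hlt
  refine ⟨k, hk0, hk.symm, fun i => ⟨fun hi => hlt.trans_le (pDown_antitone p hi), fun hi => ?_⟩⟩
  rcases eq_or_ne i 0 with rfl | hi0
  · exact Fin.zero_le _
  · have := le_csSup hbdd (hmem i hi0 hi)
    rw [← hk] at this
    exact Fin.le_def.2 (by omega)

theorem succ_le_fanoM_iff (hp : ∑ y, p y = 1) (hq : q ≤ pDown p 0)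
    (h : truncErr p q < 1 - pDown p 0) (i : Fin n) :
    (i : ℕ) + 1 ≤ fanoM p (truncErr p q) ↔ q < pDown p i := by
  obtain ⟨k, -, hM, hk⟩ := exists_fanoM_eq hp hq h
  rw [hM, ← hk, Fin.le_def]
  omega

/-- Beyond rank `k` nothing is cut, so `E` minus the tail consists of `k` copies of `q`. -/
theorem fanoLevel_truncErr (hp : ∑ y, p y = 1) (hq : q ≤ pDown p 0)
    (h : truncErr p q < 1 - pDown p 0) : fanoLevel p (truncErr p q) = q := by
  obtain ⟨k, hk0, hM, hk⟩ := exists_fanoM_eq hp hq h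
  have hkpos : (0 : ℝ) < (k : ℕ) := by
    exact_mod_cast Nat.pos_of_ne_zero fun h => hk0 (Fin.ext (by simpa using h))
  have hfilter : Finset.univ.filter (fun i : Fin n => (k : ℕ) + 1 ≤ (i : ℕ)) = Finset.Ioi k := by
    ext i
    rw [Finset.mem_filter, Finset.mem_Ioi, Fin.lt_def, Nat.succ_le_iff]
    simp only [Finset.mem_univ, true_and]
  have h1 : ∑ i ∈ Finset.Ioi k, min (pDown p i) q = ∑ i ∈ Finset.Ioi k, pDown p i := by
    refine Finset.sum_congr rfl fun i hi => min_eq_left (not_lt.1 fun hlt => ?_)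
    exact absurd ((hk i).2 hlt) (not_le.2 (Finset.mem_Ioi.1 hi))
  have h2 : ∑ i ∈ Finset.Ioc 0 k, min (pDown p i) q = (k : ℕ) * q := by
    rw [Finset.sum_congr rfl fun i hi =>
      min_eq_right ((hk i).1 (Finset.mem_Ioc.1 hi).2).le, Finset.sum_const, card_Ioc_zero,
      nsmul_eq_mul]
  rw [fanoLevel, hM, hfilter, truncErr_eq_sum_erase hq, sum_erase_zero_eq _ k, h1, h2,
    add_sub_cancel_right, Nat.cast_add, Nat.cast_one, add_sub_cancel_right,
    mul_div_cancel_left₀ _ hkpos.ne']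

theorem fanoDist_truncErr (hp : ∑ y, p y = 1) (hq : q ≤ pDown p 0)
    (h : truncErr p q < 1 - pDown p 0) (r : Fin n) :
    fanoDist p (truncErr p q) r = if r = 0 then 1 - truncErr p q else min (pDown p r) q := by
  rw [fanoDist, if_neg (by linarith)]
  refine if_congr Iff.rfl rfl ?_
  rw [fanoLevel_truncErr hp hq h]
  split_ifs with hr
  · exact (min_eq_right ((succ_le_fanoM_iff hp hq h r).1 hr).le).symm
  · exact (min_eq_left (not_lt.1 fun hlt => hr ((succ_le_fanoM_iff hp hq h r).2 hlt))).symm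

theorem fanoEntropy_of_le {W : ℝ} (hW : 1 - pDown p 0 ≤ W) : fanoEntropy p W = entropy p := by
  simp only [fanoEntropy, entropy, fanoDist, if_pos (show 1 - W ≤ pDown p 0 by linarith)]
  exact sum_comp_pDown p Real.negMulLog

theorem truncEntropy_eq_sum_erase (hq : q ≤ pDown p 0) :
    truncEntropy p q = Real.negMulLog (1 - truncErr p q) +
      ∑ i ∈ Finset.univ.erase 0, Real.negMulLog (min (pDown p i) q) := by
  rw [truncEntropy, sum_comp_eq_pDown_zero_add p (fun x => Real.negMulLog (min x q)),
    min_eq_right hq]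
  ring

theorem fanoEntropy_truncErr (hp : ∑ y, p y = 1) (hq : q ≤ pDown p 0) :
    fanoEntropy p (truncErr p q) = truncEntropy p q := by
  rw [truncEntropy_eq_sum_erase hq]
  rcases lt_or_ge (truncErr p q) (1 - pDown p 0) with h | h
  · simp only [fanoEntropy, entropy, fanoDist_truncErr hp hq h]
    rw [← Finset.add_sum_erase _ _ (Finset.mem_univ 0), if_pos rfl]
    congr 1
    exact Finset.sum_congr rfl fun i hi => by rw [if_neg (Finset.ne_of_mem_erase hi)]
  -- At the endpoint the definition switches to `p↓` itself; both descriptions agree because only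
  -- rank one can exceed `q`.
  · have hE := le_antisymm (truncErr_le hp hq) h
    rw [fanoEntropy_of_le h, hE, entropy, sum_comp_eq_pDown_zero_add p Real.negMulLog,
      sub_sub_cancel]
    congr 1
    refine Finset.sum_congr rfl fun i hi => ?_
    rw [min_eq_left (pDown_le_of_le_truncErr hp hq h (Finset.ne_of_mem_erase hi))]

theorem truncEntropy_pDown_zero (hp : ∑ y, p y = 1) :
    truncEntropy p (pDown p 0) = entropy p := by
  rw [← fanoEntropy_truncErr hp le_rfl, truncErr_pDown_zero hp, fanoEntropy_of_le le_rfl]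

end Truncation

/-! ### Conditional entropy of a joint distribution -/

/-- The conditional entropy `S(Y | X)` of a joint distribution of `(X, Y)`. -/
noncomputable def condEntropy {n : ℕ} (u : Fin n → Fin n → ℝ) : ℝ :=
  entropy (fun z : Fin n × Fin n => u z.1 z.2) - entropy (fun x => ∑ y, u x y)

section CondEntropy

variable {n : ℕ} {u : Fin n → Fin n → ℝ} {p : Fin n → ℝ} {q : ℝ}

theorem condEntropy_eq_sum (u : Fin n → Fin n → ℝ) :
    condEntropy u = ∑ x, (∑ y, Real.negMulLog (u x y) - Real.negMulLog (∑ y, u x y)) := by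
  rw [condEntropy, entropy, entropy, Fintype.sum_prod_type, Finset.sum_sub_distrib]

/-- This is `log z ≤ z - 1` at `z = s b / a`, multiplied by `a`: `b` is compared with the
conditional probability `a / s`. The remainder `s b - a` is kept because it becomes nonpositive only
after summation. -/
theorem negMulLog_le_of_gibbs {a b s : ℝ} (ha : 0 ≤ a) (hb : 0 ≤ b) (has : a ≤ s)
    (hab : b = 0 → a = 0) :
    Real.negMulLog a ≤ a * -Real.log b - a * Real.log s + (s * b - a) := by
  rcases ha.eq_or_lt with rfl | ha
  · simp [mul_nonneg has hb]
  · have hb' : 0 < b := lt_of_le_of_ne hb fun h => ha.ne' (hab h.symm)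
    have hs : 0 < s := ha.trans_le has
    have h := Real.log_le_sub_one_of_pos (div_pos (mul_pos hs hb') ha)
    rw [Real.log_div (mul_pos hs hb').ne' ha.ne', Real.log_mul hs.ne' hb'.ne'] at h
    have h2 := mul_le_mul_of_nonneg_left h ha.le
    rw [mul_sub a (s * b / a), mul_div_cancel₀ _ ha.ne'] at h2
    rw [Real.negMulLog]
    linarith

/-- Gibbs' inequality for conditional distributions. -/
theorem condEntropy_le_cross (hu : ∀ x y, 0 ≤ u x y) {b : Fin n → Fin n → ℝ}
    (hb : ∀ x y, 0 ≤ b x y) (hb1 : ∀ x, ∑ y, b x y ≤ 1) (hub : ∀ x y, b x y = 0 → u x y = 0) :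
    condEntropy u ≤ ∑ x, ∑ y, u x y * -Real.log (b x y) := by
  rw [condEntropy_eq_sum]
  refine Finset.sum_le_sum fun x _ => ?_
  set s := ∑ y, u x y with hs
  have hs0 : 0 ≤ s := Finset.sum_nonneg fun y _ => hu x y
  have h := Finset.sum_le_sum fun y (_ : y ∈ Finset.univ) =>
    negMulLog_le_of_gibbs (hu x y) (hb x y)
      (Finset.single_le_sum (fun y _ => hu x y) (Finset.mem_univ y) : u x y ≤ s) (hub x y)
  simp only [Finset.sum_add_distrib, Finset.sum_sub_distrib, ← Finset.sum_mul,
    ← Finset.mul_sum, ← hs] at h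
  -- The remainders add up to `s (∑ b) - s ≤ 0`.
  have := mul_le_mul_of_nonneg_left (hb1 x) hs0
  rw [Real.negMulLog]
  linarith

theorem condEntropy_nonneg (hu : ∀ x y, 0 ≤ u x y) : 0 ≤ condEntropy u := by
  rw [condEntropy_eq_sum]
  refine Finset.sum_nonneg fun x _ => ?_
  rw [sub_nonneg, Real.negMulLog, neg_mul, ← mul_neg, Finset.sum_mul]
  refine Finset.sum_le_sum fun y _ => ?_
  rcases (hu x y).eq_or_lt with h | h
  · simp [← h]
  · rw [Real.negMulLog, neg_mul, ← mul_neg]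
    refine mul_le_mul_of_nonneg_left (neg_le_neg (Real.log_le_log h ?_)) h.le
    exact Finset.single_le_sum (fun y _ => hu x y) (Finset.mem_univ y)

theorem apply_eq_zero_of_marginal (hu : ∀ x y, 0 ≤ u x y) (hY : ∀ y, ∑ x, u x y = p y)
    {x y : Fin n} (h : p y = 0) : u x y = 0 := by
  rw [← hY y] at h
  exact (Finset.sum_eq_zero_iff_of_nonneg fun x _ => hu x y).1 h x (Finset.mem_univ x)

/-- Gibbs' inequality with the marginal of `Y` as the conditional law for every `x`. -/
theorem condEntropy_le_entropy (hp : p ∈ stdSimplex ℝ (Fin n)) (hu : ∀ x y, 0 ≤ u x y)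
    (hY : ∀ y, ∑ x, u x y = p y) : condEntropy u ≤ entropy p := by
  refine (condEntropy_le_cross hu (b := fun _ y => p y) (fun _ y => hp.1 y) (fun _ => hp.2.le)
    fun x y h => apply_eq_zero_of_marginal hu hY h).trans_eq ?_
  rw [Finset.sum_comm]
  refine Finset.sum_congr rfl fun y _ => ?_
  rw [← Finset.sum_mul, hY, Real.negMulLog, neg_mul, mul_neg]

theorem condEntropy_eq_zero_of_diag {u : Fin n → Fin n → ℝ} (hu : ∀ x y, x ≠ y → u x y = 0) :
    condEntropy u = 0 := by
  rw [condEntropy_eq_sum]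
  refine Finset.sum_eq_zero fun x _ => ?_
  rw [Finset.sum_eq_single x (fun y _ h => by rw [hu x y h.symm, Real.negMulLog_zero]) (by simp),
    Finset.sum_eq_single x (fun y _ h => hu x y h.symm) (by simp), sub_self]

theorem sum_sum_eq_one (hp : p ∈ stdSimplex ℝ (Fin n)) {u : Fin n → Fin n → ℝ}
    (hY : ∀ y, ∑ x, u x y = p y) : ∑ x, ∑ y, u x y = 1 := by
  rw [Finset.sum_comm, Finset.sum_congr rfl fun y _ => hY y, hp.2]

theorem sum_comp_ite (f : ℝ → ℝ) (x : Fin n) (c : ℝ) (b : Fin n → ℝ) :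
    ∑ y, f (if y = x then c else b y) = f c + ∑ y, f (b y) - f (b x) := by
  rw [← Finset.add_sum_erase _ _ (Finset.mem_univ x), if_pos rfl,
    ← Finset.add_sum_erase _ (fun y => f (b y)) (Finset.mem_univ x)]
  rw [Finset.sum_congr rfl fun y hy => by rw [if_neg (Finset.ne_of_mem_erase hy)]]
  ring

/-- The test law is `min (p y) q`, multiplied by `(1 - E) / q` at `y = x`. Its row `x` sums to `1`
if `p x ≥ q` and to at most `1` otherwise. The cross entropy sees `u` only through the marginal of
`Y` and the diagonal mass, hence the affine bound; its slope is the Lagrange multiplier of the error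
constraint. -/
theorem condEntropy_le_truncEntropy_add [NeZero n] (hp : p ∈ stdSimplex ℝ (Fin n))
    (hu : ∀ x y, 0 ≤ u x y) (hY : ∀ y, ∑ x, u x y = p y) (hq0 : 0 < q) (hq : q ≤ pDown p 0) :
    condEntropy u ≤ truncEntropy p q +
      (1 - truncErr p q - ∑ x, u x x) * Real.log ((1 - truncErr p q) / q) := by
  set E := truncErr p q with hE
  have hEq : q ≤ 1 - E := by linarith [truncErr_le hp.2 hq]
  have hE1 : 0 < 1 - E := hq0.trans_le hEq
  have hsum : ∑ y, min (p y) q = E + q := by rw [hE, truncErr]; ring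
  have hm0 : ∀ y, 0 ≤ min (p y) q := fun y => le_min (hp.1 y) hq0.le
  have hratio : 0 < (1 - E) / q := div_pos hE1 hq0
  have hpz : ∀ y, min (p y) q = 0 → p y = 0 := fun y h => by
    rcases min_choice (p y) q with h' | h' <;> rw [h'] at h
    · exact h
    · exact absurd h hq0.ne'
  have hcross := condEntropy_le_cross hu
    (b := fun x y => min (p y) q * if x = y then (1 - E) / q else 1)
    (fun x y => mul_nonneg (hm0 y) (by split_ifs <;> positivity)) ?_ ?_
  · refine hcross.trans_eq ?_
    have h1 : ∀ x y, u x y * -Real.log (min (p y) q * if x = y then (1 - E) / q else 1) =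
        u x y * -Real.log (min (p y) q) -
          (if x = y then u x y else 0) * Real.log ((1 - E) / q) := by
      intro x y
      rcases eq_or_ne (min (p y) q) 0 with h | h
      · simp [apply_eq_zero_of_marginal hu hY (hpz y h)]
      · split_ifs
        · rw [Real.log_mul h hratio.ne']
          ring
        · simp
    simp only [h1, Finset.sum_sub_distrib, ← Finset.sum_mul, Finset.sum_ite_eq, Finset.mem_univ,
      if_true]
    rw [Finset.sum_comm]
    simp only [← Finset.sum_mul, hY]
    -- The mass cut off, `p y - min (p y) q`, is nonzero only where the minimum is `q`, so its
    -- logarithm is `log q`.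
    have h2 : ∀ y, p y * -Real.log (min (p y) q) =
        Real.negMulLog (min (p y) q) - (p y - min (p y) q) * Real.log q := by
      intro y
      rcases le_total (p y) q with h | h
      · rw [min_eq_left h, Real.negMulLog]
        ring
      · rw [min_eq_right h, Real.negMulLog]
        ring
    simp only [h2, Finset.sum_sub_distrib, ← Finset.sum_mul]
    rw [hp.2, hsum, truncEntropy, ← hE, Real.log_div hE1.ne' hq0.ne', Real.negMulLog,
      Real.negMulLog]
    ring
  · intro x
    have h1 : ∀ y, (min (p y) q * if x = y then (1 - E) / q else 1) =
        min (p y) q + if x = y then min (p y) q * ((1 - E) / q - 1) else 0 := by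
      intro y
      split_ifs <;> ring
    simp only [h1, Finset.sum_add_distrib, Finset.sum_ite_eq, Finset.mem_univ, if_true, hsum]
    have h2 : (0 : ℝ) ≤ (1 - E) / q - 1 := by
      rw [sub_nonneg, le_div_iff₀ hq0]
      linarith
    have h3 := mul_le_mul_of_nonneg_right (min_le_right (p x) q) h2
    rw [mul_sub q, mul_div_cancel₀ _ hq0.ne'] at h3
    linarith
  · intro x y h
    rcases mul_eq_zero.1 h with h | h
    · exact apply_eq_zero_of_marginal hu hY (hpz y h)
    · split_ifs at h
      · exact absurd h hratio.ne'
      · exact absurd h one_ne_zero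

end CondEntropy

end Feedback

namespace Feedback

/-! ### The optimal final distribution and the Fano inequality -/

section Fano

variable {n : ℕ} [NeZero n] {p : Fin n → ℝ} {q W : ℝ} {σ : Equiv.Perm (Fin n)}

/-- If `x` has positive weight, both `x` and the state of rank one are cut at `q`. The swap in
`optConditional` then only moves `1 - W` to `y = x`, and every other `y` receives `min (p y) q`. -/
theorem optFinal_eq_of_lt (hp : p ∈ stdSimplex ℝ (Fin n)) (hq : q ≤ pDown p 0)
    (hσ : Antitone (p ∘ σ.symm)) (hlt : truncErr p q < 1 - pDown p 0) (x y : Fin n) :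
    optFinal p σ (truncErr p q) x y =
      (if q < p x then (p x - q) / (1 - truncErr p q - q) else 0) *
        (if y = x then 1 - truncErr p q else min (p y) q) := by
  have hpd := pDown_apply_of_antitone hσ
  have ha : optMarginal p σ (truncErr p q) x =
      if q < p x then (p x - q) / (1 - truncErr p q - q) else 0 := by
    rw [optMarginal, if_neg (by linarith), fanoDist_truncErr hp.2 hq hlt, if_pos rfl,
      fanoLevel_truncErr hp.2 hq hlt]
    exact if_congr (by rw [succ_le_fanoM_iff hp.2 hq hlt, hpd]) rfl rfl
  rw [optFinal, ha]
  split_ifs with hx hyx hyx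
  · rw [hyx, optConditional, if_pos rfl, fanoDist_truncErr hp.2 hq hlt, if_pos rfl]
  · rw [optConditional, if_neg hyx]
    congr 1
    split_ifs with hy
    · have hx0 : σ x ≠ 0 := fun h => hyx (σ.injective (hy.trans h.symm))
      rw [fanoDist_truncErr hp.2 hq hlt, if_neg hx0, hpd, min_eq_right hx.le, ← hpd y, hy,
        min_eq_right hq]
    · rw [fanoDist_truncErr hp.2 hq hlt, if_neg hy, hpd]
  · simp
  · simp

theorem optFinal_eq_of_le (hp : p ∈ stdSimplex ℝ (Fin n)) (hq : q ≤ pDown p 0)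
    (hσ : Antitone (p ∘ σ.symm)) (hle : 1 - pDown p 0 ≤ truncErr p q) (x y : Fin n) :
    optFinal p σ (truncErr p q) x y =
      (if σ x = 0 then 1 else 0) * (if y = x then 1 - truncErr p q else min (p y) q) := by
  have hpd := pDown_apply_of_antitone hσ
  have hE := le_antisymm (truncErr_le hp.2 hq) hle
  have hd : ∀ r, fanoDist p (truncErr p q) r = pDown p r := fun r => by
    rw [fanoDist, if_pos (by linarith)]
  have ha : optMarginal p σ (truncErr p q) x = if σ x = 0 then 1 else 0 := by
    rw [optMarginal, if_pos (by linarith)]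
  rw [optFinal, ha]
  split_ifs with hx hyx hyx
  · rw [hyx, optConditional, if_pos rfl, hd]
    linarith
  · have hy : σ y ≠ 0 := fun h => hyx (σ.injective (h.trans hx.symm))
    rw [optConditional, if_neg hyx, if_neg hy, hd, min_eq_left, hpd]
    rw [← hpd y]
    exact pDown_le_of_le_truncErr hp.2 hq hle hy
  · simp
  · simp

/-- The optimal final distribution mixes, with weights `a`, permutations of the extremal
distribution. -/
theorem exists_weights_optFinal (hp : p ∈ stdSimplex ℝ (Fin n)) (hq : q ≤ pDown p 0)
    (hσ : Antitone (p ∘ σ.symm)) :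
    ∃ a : Fin n → ℝ, (∀ x, 0 ≤ a x) ∧ ∑ x, a x = 1 ∧ (∀ x, a x ≠ 0 → q ≤ p x) ∧
      (∀ x, a x * (1 - truncErr p q - q) = p x - min (p x) q) ∧
      ∀ x y, optFinal p σ (truncErr p q) x y =
        a x * (if y = x then 1 - truncErr p q else min (p y) q) := by
  have hpd := pDown_apply_of_antitone hσ
  rcases lt_or_ge (truncErr p q) (1 - pDown p 0) with hlt | hle
  · have hpos : 0 < 1 - truncErr p q - q := by linarith
    have hmin : ∀ x, (if q < p x then (p x - q) / (1 - truncErr p q - q) else 0) *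
        (1 - truncErr p q - q) = p x - min (p x) q := by
      intro x
      split_ifs with hx
      · rw [div_mul_cancel₀ _ hpos.ne', min_eq_right hx.le]
      · rw [min_eq_left (not_lt.1 hx)]
        ring
    refine ⟨_, fun x => ?_, ?_, fun x hx => ?_, hmin, optFinal_eq_of_lt hp hq hσ hlt⟩
    · split_ifs with hx
      · exact div_nonneg (by linarith) hpos.le
      · exact le_rfl
    · have hsum := Finset.sum_congr rfl fun x (_ : x ∈ Finset.univ) => hmin x
      rw [← Finset.sum_mul, Finset.sum_sub_distrib, hp.2] at hsum
      refine mul_right_cancel₀ hpos.ne' (hsum.trans ?_)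
      rw [truncErr]
      ring
    · split_ifs at hx with h
      · exact h.le
      · exact absurd rfl hx
  -- Here `1 - E - q = p↓(1) - q` may be zero, so the weights are no longer quotients; the identity
  -- in product form survives because only rank one can be cut.
  · have hE := le_antisymm (truncErr_le hp.2 hq) hle
    refine ⟨_, fun x => ?_, ?_, fun x hx => ?_, fun x => ?_, optFinal_eq_of_le hp hq hσ hle⟩
    · split_ifs <;> norm_num
    · rw [Equiv.sum_comp σ (fun r => if r = 0 then (1 : ℝ) else 0)]
      simp
    · split_ifs at hx with h
      · rw [← hpd x, h]
        exact hq
      · exact absurd rfl hx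
    · split_ifs with h
      · rw [← hpd x, h, min_eq_right hq, hE]
        ring
      · rw [min_eq_left, zero_mul, sub_self]
        rw [← hpd x]
        exact pDown_le_of_le_truncErr hp.2 hq hle h

theorem optFinal_nonneg (hp : p ∈ stdSimplex ℝ (Fin n)) (hW : W ∈ Icc 0 (1 - pDown p 0))
    (hσ : Antitone (p ∘ σ.symm)) (x y : Fin n) : 0 ≤ optFinal p σ W x y := by
  obtain ⟨q, hq, rfl⟩ := exists_truncErr_eq hp hW
  obtain ⟨a, ha, -, -, -, h⟩ := exists_weights_optFinal hp hq.2 hσ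
  rw [h]
  refine mul_nonneg (ha x) ?_
  split_ifs
  · have : 0 ≤ pDown p 0 := hp.1 _
    linarith [hW.2]
  · exact le_min (hp.1 y) hq.1

/-- The weights are chosen for this: the extra diagonal mass `a y (1 - E - q)` restores what the
truncation removes at `y`. -/
theorem sum_optFinal (hp : p ∈ stdSimplex ℝ (Fin n)) (hW : W ∈ Icc 0 (1 - pDown p 0))
    (hσ : Antitone (p ∘ σ.symm)) (y : Fin n) : ∑ x, optFinal p σ W x y = p y := by
  obtain ⟨q, hq, rfl⟩ := exists_truncErr_eq hp hW
  obtain ⟨a, -, ha1, haq, hae, h⟩ := exists_weights_optFinal hp hq.2 hσ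
  have h1 : ∀ x, optFinal p σ (truncErr p q) x y =
      a x * min (p y) q + if y = x then a x * (1 - truncErr p q - min (p y) q) else 0 := by
    intro x
    rw [h]
    split_ifs <;> ring
  simp only [h1, Finset.sum_add_distrib, ← Finset.sum_mul, ha1, Finset.sum_ite_eq, Finset.mem_univ,
    if_true]
  rcases eq_or_ne (a y) 0 with h0 | h0
  · have := hae y
    rw [h0] at this ⊢
    linarith
  · have := hae y
    rw [min_eq_right (haq y h0)] at this ⊢
    linarith

theorem sum_optFinal_diag (hp : p ∈ stdSimplex ℝ (Fin n)) (hW : W ∈ Icc 0 (1 - pDown p 0))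
    (hσ : Antitone (p ∘ σ.symm)) : ∑ x, optFinal p σ W x x = 1 - W := by
  obtain ⟨q, hq, rfl⟩ := exists_truncErr_eq hp hW
  obtain ⟨a, -, ha1, -, -, h⟩ := exists_weights_optFinal hp hq.2 hσ
  simp [h, ← Finset.sum_mul, ha1]

/-- Given any `x` of positive weight, the conditional law is a permutation of the same extremal
distribution, so averaging its entropy over the weights changes nothing. -/
theorem condEntropy_optFinal (hp : p ∈ stdSimplex ℝ (Fin n)) (hW : W ∈ Icc 0 (1 - pDown p 0))
    (hσ : Antitone (p ∘ σ.symm)) : condEntropy (optFinal p σ W) = fanoEntropy p W := by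
  obtain ⟨q, hq, rfl⟩ := exists_truncErr_eq hp hW
  obtain ⟨a, -, ha1, haq, -, h⟩ := exists_weights_optFinal hp hq.2 hσ
  rw [condEntropy_eq_sum, fanoEntropy_truncErr hp.2 hq.2, ← one_mul (truncEntropy p q), ← ha1,
    Finset.sum_mul]
  refine Finset.sum_congr rfl fun x _ => ?_
  simp only [h]
  rcases eq_or_ne (a x) 0 with h0 | h0
  · simp [h0]
  · have h1 := sum_comp_ite (fun z => z) x (1 - truncErr p q) (fun y => min (p y) q)
    have h2 := sum_comp_ite Real.negMulLog x (1 - truncErr p q) (fun y => min (p y) q)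
    have h3 : ∑ y, min (p y) q = truncErr p q + q := by rw [truncErr]; ring
    simp only [min_eq_right (haq x h0), h3] at h1 h2
    rw [show 1 - truncErr p q + (truncErr p q + q) - q = 1 by ring] at h1
    simp only [Real.negMulLog_mul, Finset.sum_add_distrib, ← Finset.sum_mul, ← Finset.mul_sum, h1,
      h2, truncEntropy, Real.negMulLog_one]
    ring

/-- A joint distribution with the given marginal and error probability less than `E` has less
conditional entropy than the extremal distribution at `E`. -/
theorem condEntropy_lt_fanoEntropy (hp : p ∈ stdSimplex ℝ (Fin n)) {u : Fin n → Fin n → ℝ}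
    (hu : ∀ x y, 0 ≤ u x y) (hY : ∀ y, ∑ x, u x y = p y) {E : ℝ} (hE0 : 0 < E)
    (hE : E < 1 - pDown p 0) (hlt : 1 - ∑ x, u x x < E) : condEntropy u < fanoEntropy p E := by
  obtain ⟨q, hq, rfl⟩ := exists_truncErr_eq hp ⟨hE0.le, hE.le⟩
  have hq0 : 0 < q := lt_of_le_of_ne hq.1 fun h => hE0.ne' (by rw [← h, truncErr_zero hp.1])
  have h := condEntropy_le_truncEntropy_add hp hu hY hq0 hq.2
  have hlog : 0 < Real.log ((1 - truncErr p q) / q) :=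
    Real.log_pos (by rw [one_lt_div hq0]; linarith [hq.2])
  rw [fanoEntropy_truncErr hp.2 hq.2]
  nlinarith

/-- Fano's inequality for a given marginal. -/
theorem condEntropy_le_fanoEntropy (hp : p ∈ stdSimplex ℝ (Fin n)) {u : Fin n → Fin n → ℝ}
    (hu : ∀ x y, 0 ≤ u x y) (hY : ∀ y, ∑ x, u x y = p y) (hE0 : 0 < 1 - ∑ x, u x x) :
    condEntropy u ≤ fanoEntropy p (1 - ∑ x, u x x) := by
  rcases lt_or_ge (1 - ∑ x, u x x) (1 - pDown p 0) with hE | hE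
  · obtain ⟨q, hq, hqE⟩ := exists_truncErr_eq hp ⟨hE0.le, hE.le⟩
    have hq0 : 0 < q := lt_of_le_of_ne hq.1 fun h => hE0.ne' (by
      rw [← hqE, ← h, truncErr_zero hp.1])
    have h := condEntropy_le_truncEntropy_add hp hu hY hq0 hq.2
    rw [← hqE, fanoEntropy_truncErr hp.2 hq.2]
    have h0 : 1 - truncErr p q - ∑ x, u x x = 0 := by linarith
    rwa [h0, zero_mul, add_zero] at h
  · rw [fanoEntropy_of_le hE]
    exact condEntropy_le_entropy hp hu hY

theorem fanoEntropy_le_entropy (hp : p ∈ stdSimplex ℝ (Fin n)) (hW : W ∈ Icc 0 (1 - pDown p 0)) :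
    fanoEntropy p W ≤ entropy p := by
  obtain ⟨σ, hσ⟩ := exists_perm_antitone p
  rw [← condEntropy_optFinal hp hW hσ]
  exact condEntropy_le_entropy hp (optFinal_nonneg hp hW hσ) (sum_optFinal hp hW hσ)

theorem fanoEntropy_nonneg (hp : p ∈ stdSimplex ℝ (Fin n)) (hW : W ∈ Icc 0 (1 - pDown p 0)) :
    0 ≤ fanoEntropy p W := by
  obtain ⟨σ, hσ⟩ := exists_perm_antitone p
  rw [← condEntropy_optFinal hp hW hσ]
  exact condEntropy_nonneg (optFinal_nonneg hp hW hσ)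

/-- `optFinal` at `W` has entropy `S(p̃_W)` and error `W < E`, so the strict Fano bound at `E`
applies to it; no derivative is needed. -/
theorem strictMonoOn_fanoEntropy (hp : p ∈ stdSimplex ℝ (Fin n)) :
    StrictMonoOn (fanoEntropy p) (Icc 0 (1 - pDown p 0)) := by
  obtain ⟨σ, hσ⟩ := exists_perm_antitone p
  have key : ∀ W ∈ Icc 0 (1 - pDown p 0), ∀ E, W < E → E < 1 - pDown p 0 →
      fanoEntropy p W < fanoEntropy p E := by
    intro W hW E hWE hE
    rw [← condEntropy_optFinal hp hW hσ]
    refine condEntropy_lt_fanoEntropy hp (optFinal_nonneg hp hW hσ) (sum_optFinal hp hW hσ)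
      (hW.1.trans_lt hWE) hE ?_
    rw [sum_optFinal_diag hp hW hσ]
    linarith
  intro W hW E hE hWE
  rcases hE.2.lt_or_eq with h | h
  · exact key W hW E hWE h
  -- The strict bound is available only below the endpoint, so an intermediate error is inserted.
  · obtain ⟨E', h1, h2⟩ := exists_between hWE
    have h2' : E' < 1 - pDown p 0 := h ▸ h2
    refine (key W hW E' h1 h2').trans_le ?_
    rw [fanoEntropy_of_le h.ge]
    exact fanoEntropy_le_entropy hp ⟨hW.1.trans h1.le, h2'.le⟩

/-- Surjectivity comes from `truncEntropy`, which is continuous in the level and runs from `0` at `q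
= 0` to `S(p)` at `q = p↓(1)`. -/
theorem bijOn_fanoEntropy (hp : p ∈ stdSimplex ℝ (Fin n)) :
    BijOn (fanoEntropy p) (Icc 0 (1 - pDown p 0)) (Icc 0 (entropy p)) := by
  refine ⟨fun W hW => ⟨fanoEntropy_nonneg hp hW, fanoEntropy_le_entropy hp hW⟩,
    (strictMonoOn_fanoEntropy hp).injOn, fun s hs => ?_⟩
  have h0 : 0 ≤ pDown p 0 := hp.1 _
  rw [← truncEntropy_zero hp.1, ← truncEntropy_pDown_zero hp.2] at hs
  obtain ⟨q, hq, rfl⟩ := intermediate_value_Icc h0 (continuous_truncEntropy p).continuousOn hs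
  exact ⟨truncErr p q, ⟨truncErr_nonneg hp.1 hq.1 hq.2, truncErr_le hp.2 hq.2⟩,
    fanoEntropy_truncErr hp.2 hq.2⟩

theorem invOn_Wmin (hp : p ∈ stdSimplex ℝ (Fin n)) :
    InvOn (Wmin p) (fanoEntropy p) (Icc 0 (1 - pDown p 0)) (Icc 0 (entropy p)) :=
  (bijOn_fanoEntropy hp).invOn_invFunOn

theorem Wmin_mem (hp : p ∈ stdSimplex ℝ (Fin n)) {s : ℝ} (hs : s ∈ Icc 0 (entropy p)) :
    Wmin p s ∈ Icc 0 (1 - pDown p 0) :=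
  (bijOn_fanoEntropy hp).surjOn.mapsTo_invFunOn hs

theorem fanoEntropy_zero (hp : p ∈ stdSimplex ℝ (Fin n)) : fanoEntropy p 0 = 0 := by
  have h0 : 0 ≤ pDown p 0 := hp.1 _
  have := fanoEntropy_truncErr hp.2 h0
  rwa [truncErr_zero hp.1, truncEntropy_zero hp.1] at this

theorem Wmin_pos (hp : p ∈ stdSimplex ℝ (Fin n)) {s : ℝ} (hs : s ∈ Ioc 0 (entropy p)) :
    0 < Wmin p s := by
  have hs' := Ioc_subset_Icc_self hs
  refine lt_of_le_of_ne (Wmin_mem hp hs').1 fun h => hs.1.ne ?_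
  rw [← (invOn_Wmin hp).2 hs', ← h, fanoEntropy_zero hp]

/-- The error probability is at least the one needed for the given conditional entropy. -/
theorem Wmin_condEntropy_le (hp : p ∈ stdSimplex ℝ (Fin n)) {u : Fin n → Fin n → ℝ}
    (hu : ∀ x y, 0 ≤ u x y) (hY : ∀ y, ∑ x, u x y = p y) :
    Wmin p (condEntropy u) ≤ 1 - ∑ x, u x x := by
  have hmem : condEntropy u ∈ Icc 0 (entropy p) :=
    ⟨condEntropy_nonneg hu, condEntropy_le_entropy hp hu hY⟩
  have hW := Wmin_mem hp hmem
  have hinv := (invOn_Wmin hp).2 hmem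
  have hle : ∀ x, u x x ≤ ∑ y, u x y := fun x =>
    Finset.single_le_sum (fun y _ => hu x y) (Finset.mem_univ x)
  have hE0 : 0 ≤ 1 - ∑ x, u x x := by
    rw [sub_nonneg, ← sum_sum_eq_one hp hY]
    exact Finset.sum_le_sum fun x _ => hle x
  by_contra! hlt
  have hEmem : 1 - ∑ x, u x x ∈ Icc 0 (1 - pDown p 0) := ⟨hE0, hlt.le.trans hW.2⟩
  refine absurd (strictMonoOn_fanoEntropy hp hEmem hW hlt) (not_lt.2 ?_)
  rw [hinv]
  rcases hE0.eq_or_lt with h | h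
  -- Zero error corresponds to level `0`, where the Gibbs test law degenerates. All mass is then on
  -- the diagonal.
  · rw [← h, fanoEntropy_zero hp, condEntropy_eq_zero_of_diag]
    intro x y hxy
    have h1 : ∀ x, u x x = ∑ y, u x y := by
      have := (Finset.sum_eq_sum_iff_of_le fun x (_ : x ∈ Finset.univ) => hle x).1
        (by rw [sum_sum_eq_one hp hY]; linarith)
      exact fun x => this x (Finset.mem_univ x)
    have h2 := h1 x
    rw [← Finset.add_sum_erase _ _ (Finset.mem_univ x)] at h2
    exact (Finset.sum_eq_zero_iff_of_nonneg fun y _ => hu x y).1 (by linarith) y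
      (by simp [hxy.symm])
  · exact condEntropy_le_fanoEntropy hp hu hY h

end Fano

end Feedback

namespace Feedback

/-! ### Analysis: chain rule, minima, and a limit theorem for the regularised dissipation -/

section Analysis

open Filter Topology

theorem absolutelyContinuousOnInterval_comp {f φ : ℝ → ℝ} {a b : ℝ} {s : Set ℝ} {K : NNReal}
    (hf : AbsolutelyContinuousOnInterval f a b) (hφ : LipschitzOnWith K φ s)
    (hs : MapsTo f (uIcc a b) s) : AbsolutelyContinuousOnInterval (φ ∘ f) a b := by
  rw [absolutelyContinuousOnInterval_iff] at hf ⊢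
  intro ε hε
  -- `K + 1` instead of `K` because the Lipschitz constant may be zero.
  obtain ⟨δ, hδ, h⟩ := hf (ε / (K + 1)) (by positivity)
  refine ⟨δ, hδ, fun E hE hEδ => ?_⟩
  have h1 := h E hE hEδ
  rw [lt_div_iff₀ (by positivity)] at h1
  refine lt_of_le_of_lt ?_ h1
  rw [Finset.sum_mul]
  refine Finset.sum_le_sum fun i hi => ?_
  have h2 := hφ.dist_le_mul _ (hs (hE.1 i hi).1) _ (hs (hE.1 i hi).2)
  refine h2.trans ?_
  have h3 : 0 ≤ dist (f (E.2 i).1) (f (E.2 i).2) := dist_nonneg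
  nlinarith

variable {u v : ℝ → ℝ} {τ : ℝ}

/-- Chain rule for the entropy along an absolutely continuous curve. -/
theorem integral_negMulLog_add (hτ : 0 ≤ τ) (hv : IntervalIntegrable v volume 0 τ)
    (hu : ∀ t ∈ Icc 0 τ, u t = u 0 + ∫ s in (0 : ℝ)..t, v s) (hu0 : ∀ t ∈ Icc 0 τ, 0 ≤ u t)
    {ε : ℝ} (hε : 0 < ε) :
    ∫ t in (0 : ℝ)..τ, (-Real.log (u t + ε) - 1) * v t =
      Real.negMulLog (u τ + ε) - Real.negMulLog (u 0 + ε) := by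
  have hIcc : uIcc 0 τ = Icc 0 τ := uIcc_of_le hτ
  -- `u` is controlled only on `[0, τ]`, so the primitive is differentiated instead. The shift keeps
  -- its values in some `[ε, C]`, where `negMulLog` is Lipschitz.
  set U : ℝ → ℝ := fun t => (∫ s in (0 : ℝ)..t, v s) + (u 0 + ε) with hU
  have hUu : ∀ t ∈ Icc 0 τ, U t = u t + ε := fun t ht => by
    rw [hu t ht, hU]
    ring
  have hUac : AbsolutelyContinuousOnInterval U 0 τ :=
    (hv.absolutelyContinuousOnInterval_intervalIntegral left_mem_uIcc).fun_add
      (LipschitzOnWith.absolutelyContinuousOnInterval (K := 0)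
        ((LipschitzWith.const (u 0 + ε)).lipschitzOnWith))
  obtain ⟨C, hC⟩ := hUac.exists_bound
  have hmaps : MapsTo U (uIcc 0 τ) (Icc ε C) := fun t ht => by
    refine ⟨?_, (le_abs_self _).trans (hC t ht)⟩
    rw [hIcc] at ht
    rw [hUu t ht]
    linarith [hu0 t ht]
  have hcd : ContDiffOn ℝ 1 Real.negMulLog (Icc ε C) := by
    unfold Real.negMulLog
    refine contDiffOn_id.neg.mul (contDiffOn_id.log fun x hx => ?_)
    exact (hε.trans_le hx.1).ne'
  obtain ⟨K, hK⟩ := hcd.exists_lipschitzOnWith one_ne_zero (convex_Icc _ _) isCompact_Icc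
  have hac := absolutelyContinuousOnInterval_comp hUac hK hmaps
  have hftc := hac.integral_deriv_eq_sub
  rw [Function.comp_apply, Function.comp_apply, hUu τ ⟨hτ, le_rfl⟩, hUu 0 ⟨le_rfl, hτ⟩] at hftc
  rw [← hftc]
  refine intervalIntegral.integral_congr_ae ?_
  filter_upwards [hv.ae_hasDerivAt_integral] with t ht htm
  have htm' : t ∈ uIcc 0 τ := uIoc_subset_uIcc htm
  have h1 : HasDerivAt U (v t) t := (ht htm' 0 left_mem_uIcc).add_const _
  have hpos : U t ≠ 0 := (hε.trans_le (hmaps htm').1).ne'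
  rw [((Real.hasDerivAt_negMulLog hpos).comp t h1).deriv, hUu t (hIcc ▸ htm')]

/-- The derivative of a nonnegative absolutely continuous curve vanishes almost everywhere on its
zero set. -/
theorem ae_eq_zero_of_eq_zero (hτ : 0 ≤ τ) (hv : IntervalIntegrable v volume 0 τ)
    (hu : ∀ t ∈ Icc 0 τ, u t = u 0 + ∫ s in (0 : ℝ)..t, v s) (hu0 : ∀ t ∈ Icc 0 τ, 0 ≤ u t) :
    ∀ᵐ t ∂(volume.restrict (Ioc 0 τ)), u t = 0 → v t = 0 := by
  have hne : ∀ᵐ t : ℝ, t ≠ τ := by simp [ae_iff, measure_singleton]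
  rw [ae_restrict_iff' measurableSet_Ioc]
  filter_upwards [hv.ae_hasDerivAt_integral, hne] with t ht htτ htm h0
  have htm' : t ∈ Ioo 0 τ := ⟨htm.1, lt_of_le_of_ne htm.2 htτ⟩
  have hder := ht (by rw [uIcc_of_le hτ]; exact Ioc_subset_Icc_self htm) 0 left_mem_uIcc
  -- An interior zero of a nonnegative function is a local minimum; this is why the endpoint `τ` was
  -- removed.
  refine IsLocalMin.hasDerivAt_eq_zero ?_ hder
  filter_upwards [isOpen_Ioo.mem_nhds htm'] with s hs
  have h1 := hu t (Ioo_subset_Icc_self htm')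
  have h2 := hu s (Ioo_subset_Icc_self hs)
  have h3 := hu0 s (Ioo_subset_Icc_self hs)
  linarith

/-- If `B k` tends to `B` from between `0` and `B`, and `A + B` is nonnegative, then the integrals
of `A + B k` tend to the integral of `A + B`, provided their sum converges. -/
theorem integral_sum_add_eq_of_tendsto {ι : Type*} {μ : Measure ℝ}
    {s : Finset ι} {A B : ι → ℝ → ℝ} {Bk : ℕ → ι → ℝ → ℝ} {S : ℝ}
    (hA : ∀ i, Integrable (A i) μ) (hBk : ∀ k i, Integrable (Bk k i) μ)
    (hpos : ∀ i, ∀ᵐ t ∂μ, 0 ≤ A i t + B i t) (hmem : ∀ k i, ∀ᵐ t ∂μ, Bk k i t ∈ uIcc 0 (B i t))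
    (hlim : ∀ i, ∀ᵐ t ∂μ, Tendsto (fun k => Bk k i t) atTop (𝓝 (B i t)))
    (hS : Tendsto (fun k => ∑ i ∈ s, ∫ t, A i t + Bk k i t ∂μ) atTop (𝓝 S)) :
    (∀ i ∈ s, Integrable (fun t => A i t + B i t) μ) ∧ ∑ i ∈ s, ∫ t, A i t + B i t ∂μ = S := by
  -- Adding the integrable `|A|` makes the approximants nonnegative: if `B ≥ 0` then `Bk ≥ 0`, and
  -- if `B ≤ 0` then `A + Bk ≥ A + B ≥ 0`. Their `L¹` norms are then their integrals, which
  -- converge, so Fatou's lemma yields integrability of the limit. Dominated convergence by `|A| +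
  -- |B|` finishes.
  have hlow : ∀ k i, ∀ᵐ t ∂μ, 0 ≤ A i t + Bk k i t + |A i t| := by
    intro k i
    filter_upwards [hpos i, hmem k i] with t h1 h2
    have h3 := neg_abs_le (A i t)
    have h4 := abs_nonneg (A i t)
    rcases le_total 0 (B i t) with h | h
    · rw [uIcc_of_le h] at h2
      linarith [h2.1]
    · rw [uIcc_of_ge h] at h2
      linarith [h2.1]
  have hint : ∀ k i, Integrable (fun t => A i t + Bk k i t + |A i t|) μ := fun k i =>
    ((hA i).add (hBk k i)).add (hA i).abs
  have hSint : Integrable (fun t => ∑ i ∈ s, (A i t + B i t + |A i t|)) μ := by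
    refine integrable_of_tendsto (G := fun k t => ∑ i ∈ s, (A i t + Bk k i t + |A i t|)) ?_
      (fun k => (integrable_finsetSum s fun i _ => hint k i).aestronglyMeasurable) ?_
    · have h := (Finset.eventually_all s).2 fun i _ => hlim i
      filter_upwards [h] with t ht
      exact tendsto_finsetSum s fun i hi => ((ht i hi).const_add _).add_const _
    · have heq : ∀ k, ∫⁻ t, ‖∑ i ∈ s, (A i t + Bk k i t + |A i t|)‖ₑ ∂μ =
          ENNReal.ofReal (∑ i ∈ s, ∫ t, A i t + Bk k i t ∂μ + ∑ i ∈ s, ∫ t, |A i t| ∂μ) := by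
        intro k
        rw [← Finset.sum_add_distrib]
        have h1 : ∀ i, ∫ t, A i t + Bk k i t ∂μ + ∫ t, |A i t| ∂μ =
            ∫ t, A i t + Bk k i t + |A i t| ∂μ := fun i =>
          (integral_add ((hA i).add (hBk k i)) (hA i).abs).symm
        simp only [h1]
        rw [← integral_finsetSum s fun i _ => hint k i,
          ofReal_integral_eq_lintegral_ofReal (integrable_finsetSum s fun i _ => hint k i)]
        · refine lintegral_congr_ae ?_
          have h := (Finset.eventually_all s).2 fun i _ => hlow k i
          filter_upwards [h] with t ht
          exact Real.enorm_of_nonneg (Finset.sum_nonneg ht)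
        · have h := (Finset.eventually_all s).2 fun i _ => hlow k i
          filter_upwards [h] with t ht
          exact Finset.sum_nonneg ht
      simp only [heq]
      have h2 := ENNReal.tendsto_ofReal (hS.add_const (∑ i ∈ s, ∫ t, |A i t| ∂μ))
      rw [h2.liminf_eq]
      exact ENNReal.ofReal_ne_top
  have hABm : ∀ i, AEStronglyMeasurable (fun t => A i t + B i t) μ := fun i =>
    (hA i).aestronglyMeasurable.add
      (aestronglyMeasurable_of_tendsto_ae atTop (fun k => (hBk k i).aestronglyMeasurable) (hlim i))
  have hAB : ∀ i ∈ s, Integrable (fun t => A i t + B i t) μ := by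
    intro i hi
    refine hSint.mono' (hABm i) ?_
    have h := (Finset.eventually_all s).2 fun i _ => hpos i
    filter_upwards [h] with t ht
    rw [Real.norm_of_nonneg (ht i hi)]
    have h1 : A i t + B i t ≤ A i t + B i t + |A i t| := by linarith [abs_nonneg (A i t)]
    refine h1.trans (Finset.single_le_sum (f := fun i => A i t + B i t + |A i t|)
      (fun j hj => ?_) hi)
    exact add_nonneg (ht j hj) (abs_nonneg _)
  refine ⟨hAB, tendsto_nhds_unique (tendsto_finsetSum s fun i hi => ?_) hS⟩
  have hB : Integrable (B i) μ := ((hAB i hi).sub (hA i)).congr (by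
    filter_upwards with t
    simp)
  refine tendsto_integral_of_dominated_convergence (fun t => |A i t| + |B i t|)
    (fun k => ((hA i).add (hBk k i)).aestronglyMeasurable) ((hA i).abs.add hB.abs) (fun k => ?_) ?_
  · filter_upwards [hmem k i] with t ht
    refine (abs_add_le _ _).trans (add_le_add le_rfl ?_)
    rcases le_total 0 (B i t) with h | h
    · rw [uIcc_of_le h] at ht
      rw [abs_of_nonneg ht.1, abs_of_nonneg h]
      exact ht.2
    · rw [uIcc_of_ge h] at ht
      rw [abs_of_nonpos ht.2, abs_of_nonpos h]
      linarith [ht.1]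
  · filter_upwards [hlim i] with t ht
    exact ht.const_add _

/-- The regularised log-ratio lies between `0` and the log-ratio. -/
theorem log_add_sub_log_add_mem_uIcc {a b ε : ℝ} (ha : 0 < a) (hb : 0 < b) (hε : 0 ≤ ε) :
    Real.log (a + ε) - Real.log (b + ε) ∈ uIcc 0 (Real.log a - Real.log b) := by
  have key : ∀ {a b : ℝ}, 0 < b → b ≤ a → 0 ≤ Real.log (a + ε) - Real.log (b + ε) ∧
      Real.log (a + ε) - Real.log (b + ε) ≤ Real.log a - Real.log b := by
    intro a b hb h
    have ha : 0 < a := hb.trans_le h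
    refine ⟨sub_nonneg.2 (Real.log_le_log (by positivity) (by linarith)), ?_⟩
    rw [← Real.log_div (by positivity) (by positivity), ← Real.log_div ha.ne' hb.ne']
    refine Real.log_le_log (by positivity) ?_
    rw [div_le_div_iff₀ (by positivity) hb]
    nlinarith
  rcases le_total b a with h | h
  · obtain ⟨h1, h2⟩ := key hb h
    rw [uIcc_of_le (h1.trans h2)]
    exact ⟨h1, h2⟩
  · obtain ⟨h1, h2⟩ := key ha h
    rw [uIcc_of_ge (by linarith)]
    exact ⟨by linarith, by linarith⟩

end Analysis

end Feedback

namespace Feedback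

theorem current_swap {n : ℕ} (R : ℝ → Fin n → Fin n → Fin n → ℝ) (p : ℝ → Fin n → Fin n → ℝ)
    (t : ℝ) (y x x' : Fin n) : current R p t y x' x = -current R p t y x x' :=
  (neg_sub _ _).symm

/-- Summation by parts on a graph. The constant `-1` costs nothing because antisymmetric currents
sum to zero; it matches the derivative of `negMulLog`. -/
theorem sum_antisymm_mul_sub {n : ℕ} {J : Fin n → Fin n → ℝ} (hJ : ∀ x x', J x' x = -J x x')
    (g : Fin n → ℝ) :
    ∑ x, ∑ x', J x x' * (g x' - g x) = 2 * ∑ x, (-g x - 1) * ∑ x', J x x' := by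
  have h1 : ∑ x, ∑ x', J x x' * g x' = -∑ x, ∑ x', J x x' * g x := by
    rw [Finset.sum_comm, ← Finset.sum_neg_distrib]
    refine Finset.sum_congr rfl fun x _ => ?_
    rw [← Finset.sum_neg_distrib]
    refine Finset.sum_congr rfl fun x' _ => ?_
    rw [hJ x x']
    ring
  have h2 : ∑ x, ∑ x', J x x' = 0 := by
    have h3 : ∑ x, ∑ x', J x x' = -∑ x, ∑ x', J x x' := by
      conv_lhs => rw [Finset.sum_comm]
      simp only [← Finset.sum_neg_distrib, ← hJ]
    linarith
  simp only [mul_sub, sub_mul, Finset.sum_sub_distrib, h1, one_mul, neg_mul, Finset.mul_sum,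
    Finset.sum_neg_distrib, h2]
  simp only [mul_comm (J _ _), ← Finset.mul_sum]
  ring

namespace FeedbackProcess

open Filter Topology

variable {n : ℕ} {G : Fin n → SimpleGraph (Fin n)} {pY : Fin n → ℝ} {β τ : ℝ}
  (P : FeedbackProcess G pY β τ)

/-! ### Conservation laws -/

theorem flux_nonneg {t : ℝ} (ht : t ∈ Icc 0 τ) (y x x' : Fin n) : 0 ≤ flux P.rate P.prob t y x x' :=
  mul_nonneg (P.rate_nonneg t y x x') (P.prob_nonneg t ht x' y)

theorem flux_self (t : ℝ) (y x : Fin n) : flux P.rate P.prob t y x x = 0 := by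
  rw [flux, P.rate_eq_zero t y x x (G y).irrefl, zero_mul]

theorem current_integrable (y x x' : Fin n) :
    IntervalIntegrable (fun t => current P.rate P.prob t y x x') volume 0 τ :=
  (P.flux_integrable y x x').sub (P.flux_integrable y x' x)

theorem sum_current_integrable (x y : Fin n) :
    IntervalIntegrable (fun t => ∑ x', current P.rate P.prob t y x x') volume 0 τ := by
  have := IntervalIntegrable.sum Finset.univ fun x' _ => P.current_integrable y x x'
  simpa only [Finset.sum_apply, Finset.sum_fn] using this

theorem prob_eq {t : ℝ} (ht : t ∈ Icc 0 τ) (x y : Fin n) : P.prob t x y = P.prob 0 x y +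
    ∫ s in (0 : ℝ)..t, ∑ x', current P.rate P.prob s y x x' :=
  P.master t ht x y

theorem continuousOn_prob (hτ : 0 ≤ τ) (x y : Fin n) :
    ContinuousOn (fun t => P.prob t x y) (uIcc 0 τ) := by
  have h := intervalIntegral.continuousOn_primitive_interval' (P.sum_current_integrable x y)
    left_mem_uIcc
  refine (h.const_add (P.prob 0 x y)).congr fun t ht => ?_
  exact P.prob_eq (by rwa [uIcc_of_le hτ] at ht) x y

theorem sum_prob {t : ℝ} (ht : t ∈ Icc 0 τ) (y : Fin n) : ∑ x, P.prob t x y = pY y := by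
  have hsub : uIcc 0 t ⊆ uIcc 0 τ :=
    uIcc_subset_uIcc_left (by rwa [uIcc_of_le (ht.1.trans ht.2)])
  have h1 : ∑ x, ∫ s in (0 : ℝ)..t, ∑ x', current P.rate P.prob s y x x' = 0 := by
    rw [← intervalIntegral.integral_finsetSum fun x _ =>
      (P.sum_current_integrable x y).mono_set hsub]
    refine (intervalIntegral.integral_congr fun s _ => ?_).trans intervalIntegral.integral_zero
    have h2 : ∑ x, ∑ x', current P.rate P.prob s y x x' =
        -∑ x, ∑ x', current P.rate P.prob s y x x' := by
      conv_lhs => rw [Finset.sum_comm]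
      simp only [← Finset.sum_neg_distrib, ← current_swap]
    linarith
  rw [Finset.sum_congr rfl fun x _ => P.prob_eq ht x y, Finset.sum_add_distrib, h1, add_zero]
  simp [P.prob_zero]

/-! ### Information -/

theorem condEntropy_prob_zero : condEntropy (P.prob 0) = 0 :=
  condEntropy_eq_zero_of_diag fun x y h => by rw [P.prob_zero, if_neg h]

theorem mutualInfo_eq {t : ℝ} (ht : t ∈ Icc 0 τ) :
    P.mutualInfo t = entropy pY - condEntropy (P.prob t) := by
  have h : P.probY t = pY := funext fun y => P.sum_prob ht y
  rw [mutualInfo, h, condEntropy]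
  unfold probX
  ring

theorem deltaI_eq (hτ : 0 ≤ τ) : P.deltaI = -condEntropy (P.prob τ) := by
  rw [deltaI, P.mutualInfo_eq ⟨hτ, le_rfl⟩, P.mutualInfo_eq ⟨le_rfl, hτ⟩, condEntropy_prob_zero]
  ring

theorem abs_deltaI (hτ : 0 ≤ τ) : |P.deltaI| = condEntropy (P.prob τ) := by
  rw [P.deltaI_eq hτ, abs_neg,
    abs_of_nonneg (condEntropy_nonneg (P.prob_nonneg τ ⟨hτ, le_rfl⟩))]

/-- The total entropy production. -/
noncomputable def entropyProduction : ℝ :=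
  entropy (fun z : Fin n × Fin n => P.prob τ z.1 z.2) -
    entropy (fun z : Fin n × Fin n => P.prob 0 z.1 z.2) - β * P.totalHeat

/-- By the chain rule the two entropy productions differ by the change of `S(Y | X)`, which starts
at `0` and ends at `|ΔI|`. -/
theorem entropyProductionX_eq (hτ : 0 ≤ τ) :
    P.entropyProductionX = -|P.deltaI| + P.entropyProduction := by
  have h0 := P.condEntropy_prob_zero
  rw [P.abs_deltaI hτ, entropyProductionX, entropyProduction]
  unfold condEntropy probX at *
  linarith

/-! ### The entropy production as an integral of current times force -/

/-- At almost every time, a transition in use is used in both directions. -/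
theorem ae_pos_of_flux_ne_zero (hτ : 0 ≤ τ) : ∀ᵐ t ∂(volume.restrict (Ioc 0 τ)), ∀ y x x',
    flux P.rate P.prob t y x x' ≠ 0 → 0 < P.rate t y x x' ∧ 0 < P.rate t y x' x ∧
      0 < P.prob t x y ∧ 0 < P.prob t x' y := by
  have h0 : ∀ᵐ t ∂(volume.restrict (Ioc 0 τ)), ∀ x y, P.prob t x y = 0 →
      ∑ x', current P.rate P.prob t y x x' = 0 := by
    refine ae_all_iff.2 fun x => ae_all_iff.2 fun y => ?_
    exact ae_eq_zero_of_eq_zero hτ (P.sum_current_integrable x y) (fun t ht => P.prob_eq ht x y)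
      fun t ht => P.prob_nonneg t ht x y
  filter_upwards [h0, ae_restrict_mem measurableSet_Ioc] with t ht htm y x x' hne
  have htm' := Ioc_subset_Icc_self htm
  have hr : P.rate t y x x' ≠ 0 := left_ne_zero_of_mul hne
  refine ⟨(P.rate_nonneg t y x x').lt_of_ne' hr,
    (P.rate_nonneg t y x' x).lt_of_ne' fun h => hr (P.rate_bidirectional t y x' x h),
    (P.prob_nonneg t htm' x y).lt_of_ne' fun h => hne ?_,
    (P.prob_nonneg t htm' x' y).lt_of_ne' (right_ne_zero_of_mul hne)⟩
  -- An empty state `(x, y)` has no outflow, so its net current is a sum of nonnegative influxes.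
  -- That sum vanishes for almost every such time, hence so does each influx.
  have h1 := ht x y h
  have h2 : ∀ x'', current P.rate P.prob t y x x'' = flux P.rate P.prob t y x x'' := fun x'' => by
    rw [current, flux, flux, h, mul_zero, sub_zero]
  rw [Finset.sum_congr rfl fun x'' _ => h2 x''] at h1
  exact (Finset.sum_eq_zero_iff_of_nonneg fun x'' _ => P.flux_nonneg htm' y x x'').1 h1 x'
    (Finset.mem_univ x')

theorem ae_flux_pos_or_eq_zero (hτ : 0 ≤ τ) : ∀ᵐ t ∂(volume.restrict (Ioc 0 τ)), ∀ y x x',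
    (0 < flux P.rate P.prob t y x x' ∧ 0 < flux P.rate P.prob t y x' x) ∨
    (flux P.rate P.prob t y x x' = 0 ∧ flux P.rate P.prob t y x' x = 0) := by
  filter_upwards [P.ae_pos_of_flux_ne_zero hτ] with t ht y x x'
  by_cases h : flux P.rate P.prob t y x x' = 0
  · by_cases h' : flux P.rate P.prob t y x' x = 0
    · exact Or.inr ⟨h, h'⟩
    · obtain ⟨h1, h2, h3, h4⟩ := ht y x' x h'
      exact Or.inl ⟨mul_pos h2 h3, mul_pos h1 h4⟩
  · obtain ⟨h1, h2, h3, h4⟩ := ht y x x' h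
    exact Or.inl ⟨mul_pos h1 h4, mul_pos h2 h3⟩

theorem ae_current_mul_force (hτ : 0 ≤ τ) : ∀ᵐ t ∂(volume.restrict (Ioc 0 τ)), ∀ y x x',
    0 ≤ current P.rate P.prob t y x x' * force P.rate P.prob t y x x' := by
  filter_upwards [P.ae_flux_pos_or_eq_zero hτ] with t ht y x x'
  rw [current, force]
  rcases ht y x x' with ⟨h1, h2⟩ | ⟨h1, h2⟩
  · rw [Real.log_div h1.ne' h2.ne']
    rcases le_total (flux P.rate P.prob t y x x') (flux P.rate P.prob t y x' x) with h | h
    · exact mul_nonneg_of_nonpos_of_nonpos (by linarith)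
        (by linarith [Real.log_le_log h1 h])
    · exact mul_nonneg (by linarith) (by linarith [Real.log_le_log h2 h])
  · simp [h1, h2]

/-- The heat is antisymmetric in the direction of the jump, so this part of `J F` splits into the
heats of the two directions, whose integrability is part of the structure. -/
theorem current_mul_log_rate (hβ : β ≠ 0) (t : ℝ) (y x x' : Fin n) :
    current P.rate P.prob t y x x' * Real.log (P.rate t y x x' / P.rate t y x' x) =
      -β * (heat P.rate β t y x x' * flux P.rate P.prob t y x x') +
        -β * (heat P.rate β t y x' x * flux P.rate P.prob t y x' x) := by
  have h : Real.log (P.rate t y x' x / P.rate t y x x') =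
      -Real.log (P.rate t y x x' / P.rate t y x' x) := by rw [← Real.log_inv, inv_div]
  rw [heat, heat, h, current]
  field_simp
  ring

theorem current_mul_log_rate_integrable (hβ : β ≠ 0) (y x x' : Fin n) :
    IntervalIntegrable (fun t => current P.rate P.prob t y x x' *
      Real.log (P.rate t y x x' / P.rate t y x' x)) volume 0 τ := by
  simp only [P.current_mul_log_rate hβ]
  exact ((P.heat_integrable y x x').const_mul _).add ((P.heat_integrable y x' x).const_mul _)

theorem current_mul_log_add_integrable (hτ : 0 ≤ τ) {ε : ℝ} (hε : 0 < ε) (y x x' : Fin n) :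
    IntervalIntegrable (fun t => current P.rate P.prob t y x x' *
      (Real.log (P.prob t x' y + ε) - Real.log (P.prob t x y + ε))) volume 0 τ := by
  have h : ∀ x, ContinuousOn (fun t => Real.log (P.prob t x y + ε)) (uIcc 0 τ) := fun x =>
    ((P.continuousOn_prob hτ x y).add continuousOn_const).log fun t ht => by
      rw [uIcc_of_le hτ] at ht
      exact (add_pos_of_nonneg_of_pos (P.prob_nonneg t ht x y) hε).ne'
  exact (P.current_integrable y x x').mul_continuousOn ((h x').sub (h x))

theorem log_mul_sum_current_integrable (hτ : 0 ≤ τ) {ε : ℝ} (hε : 0 < ε) (x y : Fin n) :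
    IntervalIntegrable (fun t => (-Real.log (P.prob t x y + ε) - 1) *
      ∑ x', current P.rate P.prob t y x x') volume 0 τ := by
  refine (P.sum_current_integrable x y).continuousOn_mul ?_
  refine (ContinuousOn.neg ?_).sub continuousOn_const
  refine ((P.continuousOn_prob hτ x y).add continuousOn_const).log fun t ht => ?_
  rw [uIcc_of_le hτ] at ht
  exact (add_pos_of_nonneg_of_pos (P.prob_nonneg t ht x y) hε).ne'

/-- The regularised dissipation. -/
theorem integral_regularised (hβ : β ≠ 0) (hτ : 0 ≤ τ) {ε : ℝ} (hε : 0 < ε) :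
    ∑ i : Fin n × Fin n × Fin n, ∫ t in (0 : ℝ)..τ,
      (current P.rate P.prob t i.1 i.2.1 i.2.2 *
          Real.log (P.rate t i.1 i.2.1 i.2.2 / P.rate t i.1 i.2.2 i.2.1) +
        current P.rate P.prob t i.1 i.2.1 i.2.2 *
          (Real.log (P.prob t i.2.2 i.1 + ε) - Real.log (P.prob t i.2.1 i.1 + ε))) =
    2 * (∑ y, ∑ x, (Real.negMulLog (P.prob τ x y + ε) - Real.negMulLog (P.prob 0 x y + ε)) -
      β * P.totalHeat) := by
  have hheat : P.totalHeat = ∑ y, ∑ x, ∑ x', ∫ t in (0 : ℝ)..τ,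
      heat P.rate β t y x x' * flux P.rate P.prob t y x x' := by
    rw [totalHeat, intervalIntegral.integral_finsetSum]
    · refine Finset.sum_congr rfl fun y _ => ?_
      rw [intervalIntegral.integral_finsetSum]
      · refine Finset.sum_congr rfl fun x _ => ?_
        rw [intervalIntegral.integral_finsetSum fun x' _ => P.heat_integrable y x x']
      · intro x _
        have := IntervalIntegrable.sum Finset.univ fun x' _ => P.heat_integrable y x x'
        simpa only [Finset.sum_apply, Finset.sum_fn] using this
    · intro y _
      have := IntervalIntegrable.sum Finset.univ fun x _ =>
        IntervalIntegrable.sum Finset.univ fun x' _ => P.heat_integrable y x x'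
      simpa only [Finset.sum_apply, Finset.sum_fn] using this
  have hA : ∀ y, ∑ x, ∑ x', ∫ t in (0 : ℝ)..τ, current P.rate P.prob t y x x' *
      Real.log (P.rate t y x x' / P.rate t y x' x) = -2 * β * ∑ x, ∑ x', ∫ t in (0 : ℝ)..τ,
        heat P.rate β t y x x' * flux P.rate P.prob t y x x' := by
    intro y
    have h1 : ∀ x x', ∫ t in (0 : ℝ)..τ, current P.rate P.prob t y x x' *
        Real.log (P.rate t y x x' / P.rate t y x' x) =
        -β * (∫ t in (0 : ℝ)..τ, heat P.rate β t y x x' * flux P.rate P.prob t y x x') +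
        -β * (∫ t in (0 : ℝ)..τ, heat P.rate β t y x' x * flux P.rate P.prob t y x' x) := by
      intro x x'
      simp only [P.current_mul_log_rate hβ]
      rw [intervalIntegral.integral_add ((P.heat_integrable y x x').const_mul _)
        ((P.heat_integrable y x' x).const_mul _), intervalIntegral.integral_const_mul,
        intervalIntegral.integral_const_mul]
    simp only [h1, Finset.sum_add_distrib, ← Finset.mul_sum]
    rw [Finset.sum_comm (f := fun x x' => ∫ t in (0 : ℝ)..τ,
      heat P.rate β t y x' x * flux P.rate P.prob t y x' x)]
    ring
  have hB : ∀ y, ∑ x, ∑ x', ∫ t in (0 : ℝ)..τ, current P.rate P.prob t y x x' *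
      (Real.log (P.prob t x' y + ε) - Real.log (P.prob t x y + ε)) =
      2 * ∑ x, (Real.negMulLog (P.prob τ x y + ε) - Real.negMulLog (P.prob 0 x y + ε)) := by
    intro y
    have hi := fun x x' => P.current_mul_log_add_integrable hτ hε y x x'
    have h1 : ∀ x, ∑ x', ∫ t in (0 : ℝ)..τ, current P.rate P.prob t y x x' *
        (Real.log (P.prob t x' y + ε) - Real.log (P.prob t x y + ε)) =
        ∫ t in (0 : ℝ)..τ, ∑ x', current P.rate P.prob t y x x' *
        (Real.log (P.prob t x' y + ε) - Real.log (P.prob t x y + ε)) := fun x =>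
      (intervalIntegral.integral_finsetSum fun x' _ => hi x x').symm
    rw [Finset.sum_congr rfl fun x _ => h1 x, ← intervalIntegral.integral_finsetSum]
    -- Summation by parts produces the time derivative of the shifted entropy, which integrates to
    -- boundary terms.
    · simp only [sum_antisymm_mul_sub (fun x x' => current_swap P.rate P.prob _ y x x')
        (fun x => Real.log (P.prob _ x y + ε))]
      rw [intervalIntegral.integral_const_mul, intervalIntegral.integral_finsetSum fun x _ =>
        P.log_mul_sum_current_integrable hτ hε x y]
      congr 1
      refine Finset.sum_congr rfl fun x _ => ?_
      exact integral_negMulLog_add hτ (P.sum_current_integrable x y)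
        (fun t ht => P.prob_eq ht x y) (fun t ht => P.prob_nonneg t ht x y) hε
    · intro x _
      have := IntervalIntegrable.sum Finset.univ fun x' _ => hi x x'
      simpa only [Finset.sum_apply, Finset.sum_fn] using this
  simp only [Fintype.sum_prod_type]
  have hsplit : ∀ y x x', ∫ t in (0 : ℝ)..τ,
      (current P.rate P.prob t y x x' * Real.log (P.rate t y x x' / P.rate t y x' x) +
        current P.rate P.prob t y x x' *
          (Real.log (P.prob t x' y + ε) - Real.log (P.prob t x y + ε))) =
      (∫ t in (0 : ℝ)..τ, current P.rate P.prob t y x x' *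
        Real.log (P.rate t y x x' / P.rate t y x' x)) +
      ∫ t in (0 : ℝ)..τ, current P.rate P.prob t y x x' *
          (Real.log (P.prob t x' y + ε) - Real.log (P.prob t x y + ε)) := fun y x x' =>
    intervalIntegral.integral_add (P.current_mul_log_rate_integrable hβ y x x')
      (P.current_mul_log_add_integrable hτ hε y x x')
  simp only [hsplit, Finset.sum_add_distrib, hA, hB, ← Finset.mul_sum, ← hheat]
  ring

/-- The force splits into `ln (R / R')`, whose product with `J` is controlled by the heat, and `ln
(p(x') / p(x))`, whose product with `J` need not be integrable a priori. The second part is shifted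
by `1 / (k + 1)`; the shifted integrals converge to the entropy balance by continuity of
`negMulLog`, and `integral_sum_add_eq_of_tendsto` passes to the limit. The factor `2` counts ordered
pairs. -/
theorem dissipation (hβ : β ≠ 0) (hτ : 0 ≤ τ) :
    (∀ y x x', IntervalIntegrable (fun t => current P.rate P.prob t y x x' *
      force P.rate P.prob t y x x') volume 0 τ) ∧
    ∑ y, ∑ x, ∑ x', ∫ t in (0 : ℝ)..τ, current P.rate P.prob t y x x' *
      force P.rate P.prob t y x x' = 2 * P.entropyProduction := by
  set A : Fin n × Fin n × Fin n → ℝ → ℝ := fun i t => current P.rate P.prob t i.1 i.2.1 i.2.2 *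
    Real.log (P.rate t i.1 i.2.1 i.2.2 / P.rate t i.1 i.2.2 i.2.1) with hA
  set B : Fin n × Fin n × Fin n → ℝ → ℝ := fun i t => current P.rate P.prob t i.1 i.2.1 i.2.2 *
    (Real.log (P.prob t i.2.2 i.1) - Real.log (P.prob t i.2.1 i.1)) with hB
  set Bk : ℕ → Fin n × Fin n × Fin n → ℝ → ℝ := fun k i t =>
    current P.rate P.prob t i.1 i.2.1 i.2.2 * (Real.log (P.prob t i.2.2 i.1 + 1 / ((k : ℝ) + 1)) -
      Real.log (P.prob t i.2.1 i.1 + 1 / ((k : ℝ) + 1))) with hBk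
  have hεk : ∀ k : ℕ, (0 : ℝ) < 1 / ((k : ℝ) + 1) := fun k => Nat.one_div_pos_of_nat
  have hε0 : Tendsto (fun k : ℕ => 1 / ((k : ℝ) + 1)) atTop (𝓝 0) :=
    tendsto_one_div_add_atTop_nhds_zero_nat
  have hAB : ∀ i : Fin n × Fin n × Fin n, ∀ᵐ t ∂(volume.restrict (Ioc 0 τ)),
      A i t + B i t = current P.rate P.prob t i.1 i.2.1 i.2.2 *
        force P.rate P.prob t i.1 i.2.1 i.2.2 := by
    rintro ⟨y, x, x'⟩
    filter_upwards [P.ae_pos_of_flux_ne_zero hτ, P.ae_flux_pos_or_eq_zero hτ] with t ht ht'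
    simp only [hA, hB, ← mul_add]
    rcases ht' y x x' with ⟨h, -⟩ | ⟨h, h'⟩
    · obtain ⟨h1, h2, h3, h4⟩ := ht y x x' h.ne'
      congr 1
      rw [force, flux, flux, Real.log_div (mul_pos h1 h4).ne' (mul_pos h2 h3).ne',
        Real.log_mul h1.ne' h4.ne', Real.log_mul h2.ne' h3.ne', Real.log_div h1.ne' h2.ne']
      ring
    · simp [current, h, h']
  have hmain := integral_sum_add_eq_of_tendsto (μ := volume.restrict (Ioc 0 τ))
    (s := Finset.univ) (A := A) (B := B) (Bk := Bk) (S := 2 * P.entropyProduction)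
    (fun i => (intervalIntegrable_iff_integrableOn_Ioc_of_le hτ).1
      (P.current_mul_log_rate_integrable hβ i.1 i.2.1 i.2.2))
    (fun k i => (intervalIntegrable_iff_integrableOn_Ioc_of_le hτ).1
      (P.current_mul_log_add_integrable hτ (hεk k) i.1 i.2.1 i.2.2)) ?_ ?_ ?_ ?_
  · obtain ⟨h1, h2⟩ := hmain
    constructor
    · intro y x x'
      refine (intervalIntegrable_iff_integrableOn_Ioc_of_le hτ).2 ?_
      exact (h1 (y, x, x') (Finset.mem_univ _)).congr (hAB (y, x, x'))
    · rw [← h2]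
      simp only [Fintype.sum_prod_type]
      refine Finset.sum_congr rfl fun y _ => Finset.sum_congr rfl fun x _ =>
        Finset.sum_congr rfl fun x' _ => ?_
      rw [intervalIntegral.integral_of_le hτ]
      exact (integral_congr_ae (hAB (y, x, x'))).symm
  · intro i
    filter_upwards [hAB i, P.ae_current_mul_force hτ] with t ht ht'
    rw [ht]
    exact ht' _ _ _
  · rintro k ⟨y, x, x'⟩
    filter_upwards [P.ae_pos_of_flux_ne_zero hτ, P.ae_flux_pos_or_eq_zero hτ] with t ht ht'
    simp only [hB, hBk]
    rcases ht' y x x' with ⟨h, -⟩ | ⟨h, h'⟩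
    · obtain ⟨-, -, h3, h4⟩ := ht y x x' h.ne'
      have h5 := log_add_sub_log_add_mem_uIcc h4 h3 (hεk k).le
      rcases le_total 0 (current P.rate P.prob t y x x') with hc | hc <;>
      rcases le_total 0 (Real.log (P.prob t x' y) - Real.log (P.prob t x y)) with hl | hl
      · rw [uIcc_of_le hl] at h5
        rw [uIcc_of_le (mul_nonneg hc hl)]
        exact ⟨mul_nonneg hc h5.1, mul_le_mul_of_nonneg_left h5.2 hc⟩
      · rw [uIcc_of_ge hl] at h5
        rw [uIcc_of_ge (mul_nonpos_of_nonneg_of_nonpos hc hl)]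
        exact ⟨mul_le_mul_of_nonneg_left h5.1 hc, mul_nonpos_of_nonneg_of_nonpos hc h5.2⟩
      · rw [uIcc_of_le hl] at h5
        rw [uIcc_of_ge (mul_nonpos_of_nonpos_of_nonneg hc hl)]
        exact ⟨mul_le_mul_of_nonpos_left h5.2 hc, mul_nonpos_of_nonpos_of_nonneg hc h5.1⟩
      · rw [uIcc_of_ge hl] at h5
        rw [uIcc_of_le (mul_nonneg_of_nonpos_of_nonpos hc hl)]
        exact ⟨mul_nonneg_of_nonpos_of_nonpos hc h5.2, mul_le_mul_of_nonpos_left h5.1 hc⟩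
    · simp [current, h, h']
  · rintro ⟨y, x, x'⟩
    filter_upwards [P.ae_pos_of_flux_ne_zero hτ, P.ae_flux_pos_or_eq_zero hτ] with t ht ht'
    simp only [hB, hBk]
    rcases ht' y x x' with ⟨h, -⟩ | ⟨h, h'⟩
    · obtain ⟨-, -, h3, h4⟩ := ht y x x' h.ne'
      have hlog : ∀ {a : ℝ}, 0 < a →
          Tendsto (fun k : ℕ => Real.log (a + 1 / ((k : ℝ) + 1))) atTop (𝓝 (Real.log a)) := by
        intro a ha
        have := hε0.const_add a
        rw [add_zero] at this
        exact this.log ha.ne'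
      exact ((hlog h4).sub (hlog h3)).const_mul _
    · simp [current, h, h']
  · have h3 : ∀ k, ∑ i, ∫ t in Ioc 0 τ, A i t + Bk k i t = 2 * (∑ y, ∑ x,
        (Real.negMulLog (P.prob τ x y + 1 / ((k : ℝ) + 1)) -
          Real.negMulLog (P.prob 0 x y + 1 / ((k : ℝ) + 1))) - β * P.totalHeat) := by
      intro k
      rw [← P.integral_regularised hβ hτ (hεk k)]
      refine Finset.sum_congr rfl fun i _ => ?_
      rw [intervalIntegral.integral_of_le hτ]
    simp only [h3]
    have h4 : P.entropyProduction = ∑ y, ∑ x, (Real.negMulLog (P.prob τ x y) -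
        Real.negMulLog (P.prob 0 x y)) - β * P.totalHeat := by
      rw [entropyProduction, entropy, entropy, Fintype.sum_prod_type, Fintype.sum_prod_type,
        Finset.sum_comm, Finset.sum_comm (f := fun x y => Real.negMulLog (P.prob 0 x y))]
      simp only [Finset.sum_sub_distrib]
    rw [h4]
    refine ((tendsto_finsetSum _ fun y _ => tendsto_finsetSum _ fun x _ => ?_).sub_const _).const_mul
      _
    have hneg : ∀ a : ℝ, Tendsto (fun k : ℕ => Real.negMulLog (a + 1 / ((k : ℝ) + 1))) atTop
        (𝓝 (Real.negMulLog a)) := by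
      intro a
      have := hε0.const_add a
      rw [add_zero] at this
      exact (Real.continuous_negMulLog.tendsto a).comp this
    exact (hneg _).sub (hneg _)

end FeedbackProcess

end Feedback

namespace Feedback

/-! ### The logarithmic mean -/

/-- The logarithmic mean of two fluxes; it vanishes if exactly one of them does. -/
noncomputable def logMean (a b : ℝ) : ℝ :=
  if a - b = 0 then a else (a - b) / Real.log (a / b)

theorem logMean_comm (a b : ℝ) : logMean a b = logMean b a := by
  unfold logMean
  by_cases h : a - b = 0
  · rw [if_pos h, if_pos (by linarith)]
    linarith
  · rw [if_neg h, if_neg fun h' => h (by linarith), ← neg_sub a b, ← inv_div a b, Real.log_inv,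
      neg_div_neg_eq]

/-- Read as `J² = m · (J F)`, the pointwise identity behind the speed limit. -/
theorem sub_sq_eq_logMean_mul {a b : ℝ} (ha : 0 < a) (hb : 0 < b) :
    (a - b) ^ 2 = logMean a b * ((a - b) * Real.log (a / b)) := by
  unfold logMean
  split_ifs with h
  · rw [h]
    ring
  · have hlog : Real.log (a / b) ≠ 0 := by
      refine Real.log_ne_zero_of_pos_of_ne_one (div_pos ha hb) fun h1 => h ?_
      rw [div_eq_one_iff_eq hb.ne'] at h1
      linarith
    field_simp

theorem logMean_nonneg {a b : ℝ} (ha : 0 < a) (hb : 0 < b) : 0 ≤ logMean a b := by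
  unfold logMean
  split_ifs with h
  · exact ha.le
  · rw [Real.log_div ha.ne' hb.ne']
    rcases le_total b a with h' | h'
    · exact div_nonneg (by linarith) (by linarith [Real.log_le_log hb h'])
    · exact div_nonneg_of_nonpos (by linarith) (by linarith [Real.log_le_log ha h'])

/-- For `a ≥ b`, `1 - b / a ≤ log (a / b)` gives the mean at most `a`. The bound makes the mobility
integrable. -/
theorem logMean_le_add {a b : ℝ} (ha : 0 < a) (hb : 0 < b) : logMean a b ≤ a + b := by
  have key : ∀ {a b : ℝ}, 0 < b → b ≤ a → logMean a b ≤ a + b := by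
    intro a b hb h
    have ha := hb.trans_le h
    unfold logMean
    split_ifs with h0
    · linarith
    · have hlt : 1 < a / b := by
        rw [one_lt_div hb]
        exact lt_of_le_of_ne h fun h1 => h0 (by linarith)
      rw [div_le_iff₀ (Real.log_pos hlt)]
      have h1 := Real.one_sub_inv_le_log_of_pos (div_pos ha hb)
      rw [inv_div] at h1
      have h2 : a * (1 - b / a) = a - b := by field_simp
      nlinarith [Real.log_pos hlt]
  rcases le_total b a with h | h
  · exact key hb h
  · rw [logMean_comm, add_comm]
    exact key ha h

theorem measurable_logMean : Measurable fun z : ℝ × ℝ => logMean z.1 z.2 := by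
  unfold logMean
  refine Measurable.ite (measurableSet_eq_fun (by fun_prop) measurable_const) (by fun_prop) ?_
  fun_prop

theorem sum_sum_Iio {n : ℕ} {f : Fin n → Fin n → ℝ} (hf : ∀ x x', f x' x = f x x')
    (hf0 : ∀ x, f x x = 0) : 2 * ∑ x, ∑ x' ∈ Finset.Iio x, f x x' = ∑ x, ∑ x', f x x' := by
  have h1 : ∑ x, ∑ x' ∈ Finset.Ioi x, f x x' = ∑ x, ∑ x' ∈ Finset.Iio x, f x x' := by
    rw [Finset.sum_comm' (t' := Finset.univ) (s' := fun x' => Finset.Iio x') (by simp)]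
    exact Finset.sum_congr rfl fun x _ => Finset.sum_congr rfl fun x' _ => hf x x'
  have h2 : ∀ x, ∑ x', f x x' = ∑ x' ∈ Finset.Iio x, f x x' + ∑ x' ∈ Finset.Ioi x, f x x' := by
    intro x
    rw [← Finset.add_sum_erase _ _ (Finset.mem_univ x), hf0, zero_add, ← Finset.sum_union]
    · refine Finset.sum_congr ?_ fun _ _ => rfl
      ext x'
      simp
    · refine Finset.disjoint_left.2 fun i hi hi' => ?_
      exact lt_asymm (Finset.mem_Iio.1 hi) (Finset.mem_Ioi.1 hi')
  rw [Finset.sum_congr rfl fun x _ => h2 x, Finset.sum_add_distrib, h1]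
  ring

/-- Row `y` and column `y` have equal sums and meet only in the vanishing diagonal entry. -/
theorem two_mul_sum_le_sum_sum {n : ℕ} {f : Fin n → Fin n → ℝ} (hf : ∀ x x', f x' x = f x x')
    (hf0 : ∀ x, f x x = 0) (hpos : ∀ x x', 0 ≤ f x x') (y : Fin n) :
    2 * ∑ x, f y x ≤ ∑ x, ∑ x', f x x' := by
  rw [← Finset.add_sum_erase _ (fun x => ∑ x', f x x') (Finset.mem_univ y), two_mul]
  refine add_le_add le_rfl ?_
  rw [← Finset.add_sum_erase _ _ (Finset.mem_univ y), hf0, zero_add]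
  refine Finset.sum_le_sum fun x _ => ?_
  rw [← hf]
  exact Finset.single_le_sum (fun x' _ => hpos x x') (Finset.mem_univ y)

namespace FeedbackProcess

variable {n : ℕ} {G : Fin n → SimpleGraph (Fin n)} {pY : Fin n → ℝ} {β τ : ℝ}
  (P : FeedbackProcess G pY β τ)

/-! ### Mobility -/

theorem ae_localMobility (hτ : 0 ≤ τ) : ∀ᵐ t ∂(volume.restrict (Ioc 0 τ)), ∀ y x x',
    0 ≤ localMobility P.rate P.prob t y x x' ∧
    localMobility P.rate P.prob t y x x' ≤
      flux P.rate P.prob t y x x' + flux P.rate P.prob t y x' x ∧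
    current P.rate P.prob t y x x' ^ 2 = localMobility P.rate P.prob t y x x' *
      (current P.rate P.prob t y x x' * force P.rate P.prob t y x x') := by
  filter_upwards [P.ae_flux_pos_or_eq_zero hτ] with t ht y x x'
  rcases ht y x x' with ⟨h1, h2⟩ | ⟨h1, h2⟩
  · exact ⟨logMean_nonneg h1 h2, logMean_le_add h1 h2, sub_sq_eq_logMean_mul h1 h2⟩
  · simp [localMobility, current, h1, h2]

theorem localMobility_integrable (hτ : 0 ≤ τ) (y x x' : Fin n) :
    IntervalIntegrable (fun t => localMobility P.rate P.prob t y x x') volume 0 τ := by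
  have h := fun x x' =>
    (intervalIntegrable_iff_integrableOn_Ioc_of_le hτ).1 (P.flux_integrable y x x')
  rw [intervalIntegrable_iff_integrableOn_Ioc_of_le hτ]
  refine Integrable.mono' ((h x x').add (h x' x)) ?_ ?_
  · exact (measurable_logMean.comp_aemeasurable
      ((h x x').aemeasurable.prodMk (h x' x).aemeasurable)).aestronglyMeasurable
  · filter_upwards [P.ae_localMobility hτ] with t ht
    rw [Real.norm_of_nonneg (ht y x x').1]
    exact (ht y x x').2.1

theorem sum_integral_localMobility (hτ : 0 < τ) :
    ∑ y, ∑ x, ∑ x', ∫ t in (0 : ℝ)..τ, localMobility P.rate P.prob t y x x' =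
      2 * (τ * P.meanMobility) := by
  have hi := fun y x x' => P.localMobility_integrable hτ.le y x x'
  have h1 : τ * P.meanMobility = ∑ y, ∑ x, ∑ x' ∈ Finset.Iio x,
      ∫ t in (0 : ℝ)..τ, localMobility P.rate P.prob t y x x' := by
    rw [meanMobility, ← mul_assoc, mul_one_div_cancel hτ.ne', one_mul,
      intervalIntegral.integral_finsetSum]
    · refine Finset.sum_congr rfl fun y _ => ?_
      rw [intervalIntegral.integral_finsetSum]
      · refine Finset.sum_congr rfl fun x _ => ?_
        rw [intervalIntegral.integral_finsetSum fun x' _ => hi y x x']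
      · intro x _
        have := IntervalIntegrable.sum (Finset.Iio x) fun x' _ => hi y x x'
        simpa only [Finset.sum_apply, Finset.sum_fn] using this
    · intro y _
      have := IntervalIntegrable.sum Finset.univ fun x _ =>
        IntervalIntegrable.sum (Finset.Iio x) fun x' _ => hi y x x'
      simpa only [Finset.sum_apply, Finset.sum_fn] using this
  rw [h1, Finset.mul_sum]
  refine Finset.sum_congr rfl fun y _ => (sum_sum_Iio (fun x x' => ?_) fun x => ?_).symm
  · have h2 : ∀ t, localMobility P.rate P.prob t y x' x = localMobility P.rate P.prob t y x x' :=
      fun t => logMean_comm _ _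
    simp only [h2]
  · have h2 : ∀ t, localMobility P.rate P.prob t y x x = 0 := fun t => by
      simp [localMobility, current, P.flux_self]
    simp [h2]

/-! ### The speed limit -/

theorem integral_abs_current_nonneg (hτ : 0 ≤ τ) (y x x' : Fin n) :
    0 ≤ ∫ t in (0 : ℝ)..τ, |current P.rate P.prob t y x x'| :=
  intervalIntegral.integral_nonneg hτ fun _ _ => abs_nonneg _

/-- The error probability is at most the total number of net jumps. -/
theorem two_mul_error_le (hpY : pY ∈ stdSimplex ℝ (Fin n)) (hτ : 0 ≤ τ) :
    2 * (1 - ∑ y, P.prob τ y y) ≤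
      ∑ y, ∑ x, ∑ x', ∫ t in (0 : ℝ)..τ, |current P.rate P.prob t y x x'| := by
  rw [← hpY.2, ← Finset.sum_sub_distrib, Finset.mul_sum]
  refine Finset.sum_le_sum fun y _ => ?_
  have h1 : ∀ x x', ∫ t in (0 : ℝ)..τ, |current P.rate P.prob t y x' x| =
      ∫ t in (0 : ℝ)..τ, |current P.rate P.prob t y x x'| := fun x x' => by
    simp only [current_swap P.rate P.prob _ y x x', abs_neg]
  have h2 : ∀ x, ∫ t in (0 : ℝ)..τ, |current P.rate P.prob t y x x| = 0 := fun x => by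
    simp [current]
  -- Only currents touching `(y, y)` are kept; they must carry away the lost mass `pY y - p_τ(y,
  -- y)`.
  refine le_trans ?_ (two_mul_sum_le_sum_sum h1 h2
    (fun x x' => P.integral_abs_current_nonneg hτ y x x') y)
  have h3 := P.prob_eq ⟨hτ, le_rfl⟩ y y
  rw [P.prob_zero, if_pos rfl,
    intervalIntegral.integral_finsetSum fun x' _ => P.current_integrable y y x'] at h3
  have h4 : -∑ x, ∫ t in (0 : ℝ)..τ, current P.rate P.prob t y y x ≤
      ∑ x, ∫ t in (0 : ℝ)..τ, |current P.rate P.prob t y y x| := by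
    rw [← Finset.sum_neg_distrib]
    refine Finset.sum_le_sum fun x _ => ?_
    exact (neg_le_abs _).trans (intervalIntegral.abs_integral_le_integral_abs hτ)
  linarith

theorem entropyProduction_nonneg (hβ : β ≠ 0) (hτ : 0 ≤ τ) : 0 ≤ P.entropyProduction := by
  have h : 0 ≤ 2 * P.entropyProduction := by
    rw [← (P.dissipation hβ hτ).2]
    refine Finset.sum_nonneg fun y _ => Finset.sum_nonneg fun x _ => Finset.sum_nonneg fun x' _ => ?_
    refine intervalIntegral.integral_nonneg_of_ae_restrict hτ ?_
    rw [Measure.restrict_congr_set Ioc_ae_eq_Icc.symm]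
    filter_upwards [P.ae_current_mul_force hτ] with t ht using ht y x x'
  linarith

theorem meanMobility_nonneg (hτ : 0 < τ) : 0 ≤ τ * P.meanMobility := by
  have h : 0 ≤ 2 * (τ * P.meanMobility) := by
    rw [← P.sum_integral_localMobility hτ]
    refine Finset.sum_nonneg fun y _ => Finset.sum_nonneg fun x _ => Finset.sum_nonneg fun x' _ => ?_
    refine intervalIntegral.integral_nonneg_of_ae_restrict hτ.le ?_
    rw [Measure.restrict_congr_set Ioc_ae_eq_Icc.symm]
    filter_upwards [P.ae_localMobility hτ.le] with t ht using (ht y x x').1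
  linarith

/-- Cauchy–Schwarz with a free weight: pointwise `|J| ≤ (r m + r⁻¹ J F) / 2` by completing the
square. Optimising `r` later replaces square roots of integrals. -/
theorem sum_integral_abs_current_le (hβ : β ≠ 0) (hτ : 0 < τ) {r : ℝ} (hr : 0 < r) :
    ∑ y, ∑ x, ∑ x', ∫ t in (0 : ℝ)..τ, |current P.rate P.prob t y x x'| ≤
      r * (τ * P.meanMobility) + r⁻¹ * P.entropyProduction := by
  have h : r * (τ * P.meanMobility) + r⁻¹ * P.entropyProduction =
      r / 2 * (∑ y, ∑ x, ∑ x', ∫ t in (0 : ℝ)..τ, localMobility P.rate P.prob t y x x') +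
      r⁻¹ / 2 * ∑ y, ∑ x, ∑ x', ∫ t in (0 : ℝ)..τ,
        current P.rate P.prob t y x x' * force P.rate P.prob t y x x' := by
    rw [P.sum_integral_localMobility hτ, (P.dissipation hβ hτ.le).2]
    ring
  rw [h]
  simp only [Finset.mul_sum, ← Finset.sum_add_distrib]
  refine Finset.sum_le_sum fun y _ => Finset.sum_le_sum fun x _ => Finset.sum_le_sum fun x' _ => ?_
  have hm := P.localMobility_integrable hτ.le y x x'
  have hd := (P.dissipation hβ hτ.le).1 y x x'
  rw [← intervalIntegral.integral_const_mul, ← intervalIntegral.integral_const_mul,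
    ← intervalIntegral.integral_add (hm.const_mul _) (hd.const_mul _)]
  refine intervalIntegral.integral_mono_ae_restrict hτ.le (P.current_integrable y x x').abs
    ((hm.const_mul _).add (hd.const_mul _)) ?_
  rw [Measure.restrict_congr_set Ioc_ae_eq_Icc.symm]
  filter_upwards [P.ae_localMobility hτ.le, P.ae_current_mul_force hτ.le] with t ht ht'
  obtain ⟨h1, -, h2⟩ := ht y x x'
  have h3 := ht' y x x'
  set m := localMobility P.rate P.prob t y x x'
  set d := current P.rate P.prob t y x x' * force P.rate P.prob t y x x'
  refine abs_le_of_sq_le_sq ?_ (by positivity)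
  have h4 : (r / 2 * m + r⁻¹ / 2 * d) ^ 2 = m * d + (r / 2 * m - r⁻¹ / 2 * d) ^ 2 := by
    field_simp
    ring
  rw [h4, h2]
  nlinarith [sq_nonneg (r / 2 * m - r⁻¹ / 2 * d)]

theorem error_sq_div_le_entropyProduction (hpY : pY ∈ stdSimplex ℝ (Fin n)) (hβ : β ≠ 0)
    (hτ : 0 < τ) {E : ℝ} (hE0 : 0 ≤ E) (hE : E ≤ 1 - ∑ y, P.prob τ y y) :
    E ^ 2 / (τ * P.meanMobility) ≤ P.entropyProduction := by
  have hS := P.entropyProduction_nonneg hβ hτ.le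
  rcases (P.meanMobility_nonneg hτ).eq_or_lt with hM | hM
  -- Division by zero returns `0`, the stated reading for vanishing mobility.
  · rw [← hM, div_zero]
    exact hS
  · rcases hE0.eq_or_lt with rfl | hE0
    · simpa using hS
    -- The weight `r = E / (τ⟨m⟩)` turns the bound into `2 E ≤ E + (τ⟨m⟩ / E) Σ`.
    · have h1 := P.sum_integral_abs_current_le hβ hτ (div_pos hE0 hM)
      have h2 := P.two_mul_error_le hpY hτ.le
      rw [div_mul_cancel₀ _ hM.ne', inv_div] at h1
      have h3 : E ≤ τ * P.meanMobility / E * P.entropyProduction := by linarith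
      rw [div_le_iff₀ hM]
      rw [div_mul_eq_mul_div, le_div_iff₀ hE0] at h3
      nlinarith

/-! ### Processes with constant uniform force -/

variable {P}

/-- For outcome `y` all mass starts at `y`, which forces `π y x y = p_τ(x, y)` and makes every other
source empty. The positive parts of `J` in the two directions add up to `|J|`, so the bound
`two_mul_error_le` becomes an equality. -/
theorem TransportsAlong.sum_integral_abs_current {π : Fin n → Fin n → Fin n → ℝ}
    (hpY : pY ∈ stdSimplex ℝ (Fin n)) (hτ : 0 ≤ τ) (h : P.TransportsAlong π)
    (hπ : IsTransportPlan (P.prob 0) (P.prob τ) π) :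
    ∑ y, ∑ x, ∑ x', ∫ t in (0 : ℝ)..τ, |current P.rate P.prob t y x x'| =
      2 * (1 - ∑ y, P.prob τ y y) := by
  have hzero : ∀ y x x', x' ≠ y → π y x x' = 0 := by
    intro y x x' hne
    have h1 := hπ.source y x'
    rw [P.prob_zero, if_neg hne] at h1
    exact (Finset.sum_eq_zero_iff_of_nonneg fun x _ => hπ.nonneg y x x').1 h1 x (Finset.mem_univ x)
  have hdiag : ∀ y x, π y x y = P.prob τ x y := by
    intro y x
    rw [← hπ.target y x, Finset.sum_eq_single y (fun x' _ hne => hzero y x x' hne) (by simp)]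
  have hJ : ∀ y x x', ∫ t in (0 : ℝ)..τ, |current P.rate P.prob t y x x'| =
      (if x = x' then 0 else π y x x') + (if x' = x then 0 else π y x' x) := by
    intro y x x'
    by_cases hne : x = x'
    · subst hne
      simp [current]
    · rw [if_neg hne, if_neg (Ne.symm hne), ← h y x x' hne, ← h y x' x (Ne.symm hne),
        ← intervalIntegral.integral_add]
      · refine intervalIntegral.integral_congr fun t _ => ?_
        simp only [current_swap P.rate P.prob t y x x', abs_eq_max_neg]
        rcases le_total 0 (current P.rate P.prob t y x x') with h0 | h0
        · rw [max_eq_left (by linarith), max_eq_left h0, max_eq_right (by linarith), add_zero]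
        · rw [max_eq_right (by linarith), max_eq_right h0, max_eq_left (by linarith), zero_add]
      · exact ⟨(P.current_integrable y x x').1.pos_part, (P.current_integrable y x x').2.pos_part⟩
      · exact ⟨(P.current_integrable y x' x).1.pos_part, (P.current_integrable y x' x).2.pos_part⟩
  have hsum : ∀ y, ∑ x, ∑ x', (if x = x' then 0 else π y x x') = pY y - P.prob τ y y := by
    intro y
    rw [← P.sum_prob ⟨hτ, le_rfl⟩ y, Finset.sum_comm,
      Finset.sum_eq_single y (fun x' _ hne => Finset.sum_eq_zero fun x _ => by
        rw [hzero y x x' hne, ite_self]) (by simp),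
      ← Finset.add_sum_erase _ (fun x => P.prob τ x y) (Finset.mem_univ y), add_sub_cancel_left,
      ← Finset.add_sum_erase _ _ (Finset.mem_univ y), if_pos rfl, zero_add]
    exact Finset.sum_congr rfl fun x hx => by rw [if_neg (Finset.ne_of_mem_erase hx), hdiag]
  have hsum' : ∀ y, ∑ x, ∑ x', (if x' = x then 0 else π y x' x) = pY y - P.prob τ y y := by
    intro y
    rw [Finset.sum_comm, hsum]
  simp only [hJ, Finset.sum_add_distrib, hsum, hsum', Finset.sum_sub_distrib, hpY.2]
  ring

/-- Almost everywhere `J F = F |J|` and `|J| = F m`; both integrate to the claimed relations. -/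
theorem HasConstantUniformForce.error_eq {F : ℝ} (hF : P.HasConstantUniformForce F)
    (hβ : β ≠ 0) (hτ : 0 < τ) {E : ℝ} (hE : 0 < E)
    (hJ : ∑ y, ∑ x, ∑ x', ∫ t in (0 : ℝ)..τ, |current P.rate P.prob t y x x'| = 2 * E) :
    E = F * (τ * P.meanMobility) ∧ P.entropyProduction = F * E := by
  rw [HasConstantUniformForce, Measure.restrict_congr_set Ioc_ae_eq_Icc.symm] at hF
  -- Otherwise the force vanishes on every transition in use, the two fluxes agree, and no net
  -- current could produce `E > 0`.
  have hF0 : 0 < F := by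
    by_contra! hF0
    refine hE.ne' ?_
    have h0 : ∀ y x x', ∫ t in (0 : ℝ)..τ, |current P.rate P.prob t y x x'| = 0 := by
      intro y x x'
      rw [intervalIntegral.integral_of_le hτ.le]
      refine integral_eq_zero_of_ae ?_
      filter_upwards [hF, P.ae_flux_pos_or_eq_zero hτ.le] with t ht ht'
      rcases ht' y x x' with ⟨h1, h2⟩ | ⟨h1, h2⟩
      · have h3 : force P.rate P.prob t y x x' = 0 := by
          rw [← abs_nonpos_iff, ht y x x' h1.ne']
          exact hF0
        have h4 := Real.eq_one_of_pos_of_log_eq_zero (div_pos h1 h2) h3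
        rw [div_eq_one_iff_eq h2.ne'] at h4
        simp [current, h4]
      · simp [current, h1, h2]
    simp only [h0, Finset.sum_const_zero] at hJ
    linarith
  have hkey : ∀ᵐ t ∂(volume.restrict (Ioc 0 τ)), ∀ y x x',
      current P.rate P.prob t y x x' * force P.rate P.prob t y x x' =
        F * |current P.rate P.prob t y x x'| ∧
      |current P.rate P.prob t y x x'| = F * localMobility P.rate P.prob t y x x' := by
    filter_upwards [hF, P.ae_flux_pos_or_eq_zero hτ.le, P.ae_localMobility hτ.le,
      P.ae_current_mul_force hτ.le] with t ht ht' hm hd y x x'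
    rcases ht' y x x' with ⟨h1, h2⟩ | ⟨h1, h2⟩
    · have h3 := ht y x x' h1.ne'
      have h4 : current P.rate P.prob t y x x' * force P.rate P.prob t y x x' =
          F * |current P.rate P.prob t y x x'| := by
        rw [← abs_of_nonneg (hd y x x'), abs_mul, h3, mul_comm]
      refine ⟨h4, ?_⟩
      have hJne : current P.rate P.prob t y x x' ≠ 0 := by
        intro h5
        have h6 : flux P.rate P.prob t y x x' = flux P.rate P.prob t y x' x := sub_eq_zero.1 h5
        rw [force, h6, div_self h2.ne', Real.log_one, abs_zero] at h3
        exact hF0.ne h3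
      have h5 := (hm y x x').2.2
      rw [h4, ← sq_abs] at h5
      refine mul_right_cancel₀ (abs_ne_zero.2 hJne) ?_
      linarith
    · simp [current, localMobility, h1, h2]
  have h1 : ∀ y x x', ∫ t in (0 : ℝ)..τ,
      current P.rate P.prob t y x x' * force P.rate P.prob t y x x' =
      F * ∫ t in (0 : ℝ)..τ, |current P.rate P.prob t y x x'| := by
    intro y x x'
    rw [← intervalIntegral.integral_const_mul, intervalIntegral.integral_of_le hτ.le,
      intervalIntegral.integral_of_le hτ.le]
    refine integral_congr_ae ?_
    filter_upwards [hkey] with t ht using (ht y x x').1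
  have h2 : ∀ y x x', ∫ t in (0 : ℝ)..τ, |current P.rate P.prob t y x x'| =
      F * ∫ t in (0 : ℝ)..τ, localMobility P.rate P.prob t y x x' := by
    intro y x x'
    rw [← intervalIntegral.integral_const_mul, intervalIntegral.integral_of_le hτ.le,
      intervalIntegral.integral_of_le hτ.le]
    refine integral_congr_ae ?_
    filter_upwards [hkey] with t ht using (ht y x x').2
  have h3 := (P.dissipation hβ hτ.le).2
  simp only [h1, ← Finset.mul_sum, hJ] at h3
  have h4 := P.sum_integral_localMobility hτ
  have h5 := hJ
  simp only [h2, ← Finset.mul_sum, h4] at h5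
  exact ⟨by linarith, by linarith⟩

theorem HasConstantUniformForce.entropyProduction_eq {F : ℝ} (hF : P.HasConstantUniformForce F)
    (hβ : β ≠ 0) (hτ : 0 < τ) {E : ℝ} (hE : 0 < E)
    (hJ : ∑ y, ∑ x, ∑ x', ∫ t in (0 : ℝ)..τ, |current P.rate P.prob t y x x'| = 2 * E) :
    P.entropyProduction = E ^ 2 / (τ * P.meanMobility) := by
  obtain ⟨h1, h2⟩ := hF.error_eq hβ hτ hE hJ
  have h3 : τ * P.meanMobility ≠ 0 := fun h => hE.ne' (by rw [h1, h, mul_zero])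
  rw [eq_div_iff h3, h2, sq]
  nth_rewrite 3 [h1]
  ring

end FeedbackProcess

end Feedback

namespace Feedback

/-! ### Processes with constant current and constant force

Probability flows at a constant rate from `(y, y)` directly to every `(x, y)`. -/

section Star

variable {n : ℕ} (pY : Fin n → ℝ) (q : Fin n → Fin n → ℝ) (τ F : ℝ)

/-- Linear interpolation between `δ_{x,y} pY(y)` and `q`. -/
noncomputable def starProb (t : ℝ) (x y : Fin n) : ℝ :=
  (1 - t / τ) * (if x = y then pY y else 0) + t / τ * q x y

/-- The fluxes with net current `q x y / τ` and force `F` from `(y, y)` to `(x, y)`. -/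
noncomputable def starFlux (y x x' : Fin n) : ℝ :=
  -- The two factors differ by `1` and have ratio `e^F`.
  if x' = y ∧ x ≠ y then q x y / τ * (Real.exp F / (Real.exp F - 1))
  else if x = y ∧ x' ≠ y then q x' y / τ * (1 / (Real.exp F - 1)) else 0

/-- The rates that generate the fluxes `starFlux` during `(0, τ)`. -/
noncomputable def starRate (t : ℝ) (y x x' : Fin n) : ℝ :=
  -- At the endpoints the denominator may vanish while the flux does not.
  if t ∈ Ioo 0 τ then starFlux q τ F y x x' / starProb pY q τ t x' y else 0

variable {pY q τ F}

theorem starFlux_nonneg (hq : ∀ x y, 0 ≤ q x y) (hτ : 0 < τ) (hF : 0 < F) (y x x' : Fin n) :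
    0 ≤ starFlux q τ F y x x' := by
  have h := sub_pos.2 (Real.one_lt_exp_iff.2 hF)
  have h1 := fun x => hq x y
  unfold starFlux
  split_ifs
  · have := h1 x
    positivity
  · have := h1 x'
    positivity
  · exact le_rfl

theorem starFlux_eq_zero_symm (hτ : 0 < τ) (hF : 0 < F) {y x x' : Fin n}
    (h : starFlux q τ F y x x' = 0) : starFlux q τ F y x' x = 0 := by
  have hF' := (sub_pos.2 (Real.one_lt_exp_iff.2 hF)).ne'
  have hexp := (Real.exp_pos F).ne'
  unfold starFlux at h ⊢
  by_cases h1 : x' = y <;> by_cases h2 : x = y <;> simp_all [hτ.ne']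

theorem starFlux_sub (hF : 0 < F) (y x x' : Fin n) :
    starFlux q τ F y x x' - starFlux q τ F y x' x =
      (if x' = y ∧ x ≠ y then q x y / τ else 0) - (if x = y ∧ x' ≠ y then q x' y / τ else 0) := by
  have hF' := (sub_pos.2 (Real.one_lt_exp_iff.2 hF)).ne'
  unfold starFlux
  by_cases h1 : x' = y <;> by_cases h2 : x = y <;> simp [h1, h2] <;> field_simp <;> ring

theorem abs_log_starFlux_div (hτ : 0 < τ) (hF : 0 < F) {y x x' : Fin n}
    (h : starFlux q τ F y x x' ≠ 0) :
    |Real.log (starFlux q τ F y x x' / starFlux q τ F y x' x)| = F := by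
  have hF' := (sub_pos.2 (Real.one_lt_exp_iff.2 hF)).ne'
  have hexp := (Real.exp_pos F).ne'
  have key : ∀ c : ℝ, c ≠ 0 → c / τ * (Real.exp F / (Real.exp F - 1)) /
      (c / τ * (1 / (Real.exp F - 1))) = Real.exp F := fun c hc => by field_simp
  unfold starFlux at h ⊢
  by_cases h1 : x' = y <;> by_cases h2 : x = y
  · simp [h1, h2] at h
  · have hc : q x y ≠ 0 := fun hc => h (by simp [h1, h2, hc])
    rw [if_pos ⟨h1, h2⟩, if_neg (by tauto), if_pos ⟨h1, h2⟩, key _ hc, Real.log_exp,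
      abs_of_pos hF]
  · have hc : q x' y ≠ 0 := fun hc => h (by simp [h1, h2, hc])
    rw [if_neg (by tauto), if_pos ⟨h2, h1⟩, if_pos ⟨h2, h1⟩, ← inv_div, key _ hc, Real.log_inv,
      Real.log_exp, abs_neg, abs_of_pos hF]
  · simp [h1, h2] at h

theorem starProb_nonneg (hp : ∀ y, 0 ≤ pY y) (hq : ∀ x y, 0 ≤ q x y) (hτ : 0 < τ) {t : ℝ}
    (ht : t ∈ Icc 0 τ) (x y : Fin n) : 0 ≤ starProb pY q τ t x y := by
  have h1 : 0 ≤ t / τ := div_nonneg ht.1 hτ.le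
  have h2 : t / τ ≤ 1 := (div_le_one hτ).2 ht.2
  unfold starProb
  refine add_nonneg (mul_nonneg (by linarith) ?_) (mul_nonneg h1 (hq x y))
  split_ifs
  · exact hp y
  · exact le_rfl

/-- Before `τ` the source `(y, y)` is not exhausted, and after `0` every target has received mass;
so dividing by the probability in `starRate` is harmless. -/
theorem starProb_ne_zero (hq : ∀ x y, 0 ≤ q x y)
    (hY : ∀ y, ∑ x, q x y = pY y) (hτ : 0 < τ) {t : ℝ} (ht : t ∈ Ioo 0 τ) {y x x' : Fin n}
    (h : starFlux q τ F y x x' ≠ 0) : starProb pY q τ t x' y ≠ 0 := by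
  have h1 : 0 < t / τ := div_pos ht.1 hτ
  have h2 : t / τ < 1 := (div_lt_one hτ).2 ht.2
  unfold starFlux at h
  split_ifs at h with h3 h4
  · obtain ⟨rfl, -⟩ := h3
    have hqx : q x x' ≠ 0 := fun h0 => h (by simp [h0])
    have hpx : 0 < pY x' := by
      rw [← hY x']
      exact Finset.sum_pos' (fun x _ => hq x x') ⟨x, Finset.mem_univ x, (hq x x').lt_of_ne' hqx⟩
    rw [starProb, if_pos rfl]
    have := mul_pos (sub_pos.2 h2) hpx
    have := mul_nonneg h1.le (hq x' x')
    linarith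
  · have hqx : q x' y ≠ 0 := fun h0 => h (by simp [h0])
    rw [starProb, if_neg h4.2, mul_zero, zero_add]
    exact mul_ne_zero h1.ne' hqx
  · exact absurd rfl h

theorem flux_star (hq : ∀ x y, 0 ≤ q x y)
    (hY : ∀ y, ∑ x, q x y = pY y) (hτ : 0 < τ) (t : ℝ) (y x x' : Fin n) :
    flux (starRate pY q τ F) (starProb pY q τ) t y x x' =
      if t ∈ Ioo 0 τ then starFlux q τ F y x x' else 0 := by
  unfold flux starRate
  split_ifs with ht
  · by_cases h : starFlux q τ F y x x' = 0
    · simp [h]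
    · exact div_mul_cancel₀ _ (starProb_ne_zero hq hY hτ ht h)
  · exact zero_mul _

theorem sum_starFlux_sub (hY : ∀ y, ∑ x, q x y = pY y) (hF : 0 < F) (x y : Fin n) :
    ∑ x', (starFlux q τ F y x x' - starFlux q τ F y x' x) =
      (q x y - if x = y then pY y else 0) / τ := by
  simp only [starFlux_sub hF]
  by_cases h : x = y
  · subst h
    have h1 := hY x
    rw [← Finset.add_sum_erase _ _ (Finset.mem_univ x)] at h1 ⊢
    rw [Finset.sum_congr rfl fun x' hx' => by
      rw [if_neg (by tauto), if_pos ⟨rfl, Finset.ne_of_mem_erase hx'⟩]]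
    simp only [zero_sub, Finset.sum_neg_distrib, ← Finset.sum_div]
    simp only [ne_eq, not_true_eq_false, and_false, if_false, if_true, ← h1]
    ring
  · simp [h]

/-- Zeros of the affine function are allowed: the logarithm of the norm of a meromorphic function is
locally integrable. This is needed because probabilities vanish at the ends of the interval. -/
theorem intervalIntegrable_log_affine (a b c d : ℝ) :
    IntervalIntegrable (fun t => Real.log (a + b * t)) volume c d := by
  have h : MeromorphicOn (fun t : ℝ => a + b * t) (uIcc c d) := fun t _ => by fun_prop
  have := h.intervalIntegrable_log_norm
  simpa only [Real.norm_eq_abs, Real.log_abs] using this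

theorem log_starProb_integrable (x y : Fin n) :
    IntervalIntegrable (fun t => Real.log (starProb pY q τ t x y)) volume 0 τ := by
  have h : ∀ t, starProb pY q τ t x y = (if x = y then pY y else 0) +
      ((q x y - if x = y then pY y else 0) / τ) * t := fun t => by
    rw [starProb]
    ring
  simp only [h]
  exact intervalIntegrable_log_affine _ _ _ _

theorem ae_Ioc_mem_Ioo (τ : ℝ) : ∀ᵐ t : ℝ, t ∈ Ioc 0 τ → t ∈ Ioo 0 τ := by
  have hne : ∀ᵐ t : ℝ, t ≠ τ := by simp [ae_iff, measure_singleton]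
  filter_upwards [hne] with t ht htm
  exact ⟨htm.1, lt_of_le_of_ne htm.2 ht⟩

theorem intervalIntegrable_of_eqOn_Ioo {f g : ℝ → ℝ} (hτ : 0 ≤ τ)
    (hg : IntervalIntegrable g volume 0 τ) (h : ∀ t ∈ Ioo 0 τ, f t = g t) :
    IntervalIntegrable f volume 0 τ := by
  rw [intervalIntegrable_iff_integrableOn_Ioo_of_le hτ] at hg ⊢
  exact hg.congr_fun (fun t ht => (h t ht).symm) measurableSet_Ioo

/-- The process that realises `starFlux`. -/
noncomputable def starProcess {G : Fin n → SimpleGraph (Fin n)} (β : ℝ) (hG : ConditionC G)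
    (hp : ∀ y, 0 ≤ pY y) (hq : ∀ x y, 0 ≤ q x y) (hY : ∀ y, ∑ x, q x y = pY y) (hτ : 0 < τ)
    (hF : 0 < F) : FeedbackProcess G pY β τ where
  rate := starRate pY q τ F
  prob := starProb pY q τ
  rate_measurable y x x' := by
    unfold starRate starProb
    exact Measurable.ite measurableSet_Ioo (by fun_prop) measurable_const
  rate_nonneg t y x x' := by
    unfold starRate
    split_ifs with ht
    · exact div_nonneg (starFlux_nonneg hq hτ hF y x x')
        (starProb_nonneg hp hq hτ (Ioo_subset_Icc_self ht) x' y)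
    · exact le_rfl
  rate_eq_zero t y x x' h := by
    have h0 : starFlux q τ F y x x' = 0 := by
      unfold starFlux
      split_ifs with h1 h2
      · obtain ⟨rfl, h1⟩ := h1
        exact absurd (hG x' x h1) h
      · obtain ⟨rfl, h2⟩ := h2
        exact absurd (hG x x' h2).symm h
      · rfl
    simp [starRate, h0]
  rate_bidirectional t y x x' h := by
    unfold starRate at h ⊢
    split_ifs at h ⊢ with ht
    · have h0 : starFlux q τ F y x x' = 0 := by
        by_contra h0
        exact (div_ne_zero h0 (starProb_ne_zero hq hY hτ ht h0)) h
      rw [starFlux_eq_zero_symm hτ hF h0, zero_div]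
    · rfl
  prob_nonneg t ht x y := starProb_nonneg hp hq hτ ht x y
  prob_zero x y := by simp [starProb]
  flux_integrable y x x' := by
    refine intervalIntegrable_of_eqOn_Ioo hτ.le
      (intervalIntegrable_const (c := starFlux q τ F y x x')) fun t ht => ?_
    rw [flux_star hq hY hτ, if_pos ht]
  master t ht x y := by
    have h1 : ∫ s in (0 : ℝ)..t, ∑ x', (flux (starRate pY q τ F) (starProb pY q τ) s y x x' -
        flux (starRate pY q τ F) (starProb pY q τ) s y x' x) =
        ∫ s in (0 : ℝ)..t, (q x y - if x = y then pY y else 0) / τ := by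
      refine intervalIntegral.integral_congr_ae ?_
      filter_upwards [ae_Ioc_mem_Ioo τ] with s hs hst
      rw [uIoc_of_le ht.1] at hst
      have hs' := hs ⟨hst.1, hst.2.trans ht.2⟩
      simp only [flux_star hq hY hτ, if_pos hs']
      exact sum_starFlux_sub hY hF x y
    rw [h1, intervalIntegral.integral_const, starProb, starProb, smul_eq_mul]
    ring
  heat_integrable y x x' := by
    by_cases h : starFlux q τ F y x x' = 0
    · refine intervalIntegrable_of_eqOn_Ioo hτ.le (intervalIntegrable_const (c := (0 : ℝ)))
        fun t ht => ?_
      rw [flux_star hq hY hτ, if_pos ht, h, mul_zero]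
    · have h' : starFlux q τ F y x' x ≠ 0 := fun h0 => h (starFlux_eq_zero_symm hτ hF h0)
      refine intervalIntegrable_of_eqOn_Ioo hτ.le
        (g := fun t => -(1 / β) * ((Real.log (starFlux q τ F y x x') -
          Real.log (starFlux q τ F y x' x)) + (Real.log (starProb pY q τ t x y) -
          Real.log (starProb pY q τ t x' y))) * starFlux q τ F y x x') ?_ fun t ht => ?_
      · exact ((intervalIntegrable_const.add ((log_starProb_integrable x y).sub
          (log_starProb_integrable x' y))).const_mul _).mul_const _
      · have h1 := starProb_ne_zero hq hY hτ ht h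
        have h2 := starProb_ne_zero hq hY hτ ht h'
        rw [flux_star hq hY hτ, if_pos ht, heat, starRate, starRate, if_pos ht, if_pos ht,
          Real.log_div (div_ne_zero h h1) (div_ne_zero h' h2), Real.log_div h h1,
          Real.log_div h' h2]
        ring

variable {G : Fin n → SimpleGraph (Fin n)} {β : ℝ}

theorem starProcess_hasConstantUniformForce (hG : ConditionC G) (hp : ∀ y, 0 ≤ pY y)
    (hq : ∀ x y, 0 ≤ q x y) (hY : ∀ y, ∑ x, q x y = pY y) (hτ : 0 < τ) (hF : 0 < F) :
    (starProcess β hG hp hq hY hτ hF).HasConstantUniformForce F := by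
  rw [FeedbackProcess.HasConstantUniformForce, Measure.restrict_congr_set Ioc_ae_eq_Icc.symm,
    ae_restrict_iff' measurableSet_Ioc]
  filter_upwards [ae_Ioc_mem_Ioo τ] with t ht htm y x x'
  simp only [starProcess, force, flux_star hq hY hτ, if_pos (ht htm)]
  exact abs_log_starFlux_div hτ hF

theorem starProb_end (hτ : τ ≠ 0) : starProb pY q τ τ = q := by
  funext x y
  simp [starProb, div_self hτ]

theorem starProcess_transportsAlong (hG : ConditionC G) (hp : ∀ y, 0 ≤ pY y)
    (hq : ∀ x y, 0 ≤ q x y) (hY : ∀ y, ∑ x, q x y = pY y) (hτ : 0 < τ) (hF : 0 < F) :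
    (starProcess β hG hp hq hY hτ hF).TransportsAlong fun y x x' => if x' = y then q x y else 0 := by
  intro y x x' hne
  have h1 : ∫ t in (0 : ℝ)..τ, max (current (starRate pY q τ F) (starProb pY q τ) t y x x') 0 =
      ∫ t in (0 : ℝ)..τ, (if x' = y then q x y else 0) / τ := by
    refine intervalIntegral.integral_congr_ae ?_
    filter_upwards [ae_Ioc_mem_Ioo τ] with s hs hst
    rw [uIoc_of_le hτ.le] at hst
    simp only [current, flux_star hq hY hτ, if_pos (hs hst), starFlux_sub hF]
    by_cases h : x' = y
    · have hx : x ≠ y := fun hx => hne (hx.trans h.symm)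
      simp [h, hx, div_nonneg (hq x y) hτ.le]
    · simp only [h, false_and, if_false, zero_sub, zero_div]
      refine max_eq_right (neg_nonpos.2 ?_)
      split_ifs
      · exact div_nonneg (hq x' y) hτ.le
      · exact le_rfl
  refine h1.trans ?_
  rw [intervalIntegral.integral_const, smul_eq_mul, sub_zero, mul_div_cancel₀ _ hτ.ne']

theorem IsTransportPlan.eq_of_diag {p : Fin n → Fin n → ℝ} {π : Fin n → Fin n → Fin n → ℝ}
    (h : IsTransportPlan p q π) (hp : ∀ x y, x ≠ y → p x y = 0) (y x x' : Fin n) :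
    π y x x' = if x' = y then q x y else 0 := by
  have hzero : ∀ x', x' ≠ y → π y x x' = 0 := fun x' hne =>
    (Finset.sum_eq_zero_iff_of_nonneg fun x _ => h.nonneg y x x').1
      ((h.source y x').trans (hp x' y hne)) x (Finset.mem_univ x)
  split_ifs with h1
  · rw [h1, ← h.target y x, Finset.sum_eq_single y (fun x' _ hne => hzero x' hne) (by simp)]
  · exact hzero x' h1

/-- Minimality of the plan is automatic: by `IsTransportPlan.eq_of_diag` a diagonal initial
distribution admits only one plan to `q`. -/
theorem starProcess_isOptimalProtocolTo (hG : ConditionC G) (hp : ∀ y, 0 ≤ pY y)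
    (hq : ∀ x y, 0 ≤ q x y) (hY : ∀ y, ∑ x, q x y = pY y) (hτ : 0 < τ) (hF : 0 < F) :
    (starProcess β hG hp hq hY hτ hF).IsOptimalProtocolTo q := by
  have hend : (starProcess β hG hp hq hY hτ hF).prob τ = q := starProb_end hτ.ne'
  refine ⟨hend, ⟨_, ⟨⟨fun y x x' => ?_, fun y x' => ?_, fun y x => ?_⟩, fun π' hπ' => ?_⟩,
    starProcess_transportsAlong hG hp hq hY hτ hF⟩, F,
    starProcess_hasConstantUniformForce hG hp hq hY hτ hF⟩
  · split_ifs
    · exact hq x y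
    · exact le_rfl
  · rw [FeedbackProcess.prob_zero]
    split_ifs with h
    · exact hY y
    · exact Finset.sum_const_zero
  · rw [hend]
    simp
  · rw [hend] at hπ'
    have h := hπ'.eq_of_diag fun x y hne => by
      rw [FeedbackProcess.prob_zero, if_neg hne]
    refine le_of_eq ?_
    congr 1
    funext y x x'
    exact (h y x x').symm

end Star

end Feedback

/-! ### The information-theoretic speed limit and its attainment. -/

theorem mainTheorem2 (n : ℕ) [NeZero n] (pY : Fin n → ℝ) (hpY : pY ∈ stdSimplex ℝ (Fin n))
    (G : Fin n → SimpleGraph (Fin n)) (β τ : ℝ) (hβ : 0 < β) (hτ : 0 < τ) :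
    -- `W ↦ S(p̃_W)` is strictly increasing on `[0, 1 - p↓(1)]`, constant beyond, and `Wmin` is
    -- its inverse `[0, S(pY)] → [0, 1 - p↓(1)]`
    (StrictMonoOn (Feedback.fanoEntropy pY) (Icc 0 (1 - Feedback.pDown pY 0)) ∧
      (∀ W, 1 - Feedback.pDown pY 0 ≤ W → Feedback.fanoEntropy pY W = Feedback.entropy pY) ∧
      BijOn (Feedback.fanoEntropy pY) (Icc 0 (1 - Feedback.pDown pY 0))
        (Icc 0 (Feedback.entropy pY)) ∧
      InvOn (Feedback.Wmin pY) (Feedback.fanoEntropy pY) (Icc 0 (1 - Feedback.pDown pY 0))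
        (Icc 0 (Feedback.entropy pY))) ∧
    -- the speed limit
    (∀ P : Feedback.FeedbackProcess G pY β τ,
      |P.deltaI| ∈ Icc 0 (Feedback.entropy pY) ∧
      P.entropyProductionX ≥
        -|P.deltaI| + Feedback.Wmin pY |P.deltaI| ^ 2 / (τ * P.meanMobility)) ∧
    -- its attainment, for every way `σ` of ranking the states by descending probability
    (Feedback.ConditionC G →
      ∀ σ : Equiv.Perm (Fin n), Antitone (pY ∘ σ.symm) →
      ∀ I ∈ Ioc 0 (Feedback.entropy pY),
        (∀ P : Feedback.FeedbackProcess G pY β τ,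
          P.IsOptimalProtocolTo (Feedback.optFinal pY σ (Feedback.Wmin pY I)) →
            |P.deltaI| = I ∧
            P.entropyProductionX =
              -|P.deltaI| + Feedback.Wmin pY |P.deltaI| ^ 2 / (τ * P.meanMobility)) ∧
        ∀ m : ℝ, 0 < m → ∃ P : Feedback.FeedbackProcess G pY β τ,
          P.IsOptimalProtocolTo (Feedback.optFinal pY σ (Feedback.Wmin pY I)) ∧
          P.meanMobility = m) := by
  have hβ' := hβ.ne'
  have hmem : ∀ P : Feedback.FeedbackProcess G pY β τ,
      |P.deltaI| ∈ Icc 0 (Feedback.entropy pY) := fun P => by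
    have hu := P.prob_nonneg τ ⟨hτ.le, le_rfl⟩
    rw [P.abs_deltaI hτ.le]
    exact ⟨Feedback.condEntropy_nonneg hu,
      Feedback.condEntropy_le_entropy hpY hu (P.sum_prob ⟨hτ.le, le_rfl⟩)⟩
  refine ⟨⟨Feedback.strictMonoOn_fanoEntropy hpY, fun W hW => Feedback.fanoEntropy_of_le hW,
    Feedback.bijOn_fanoEntropy hpY, Feedback.invOn_Wmin hpY⟩, fun P => ⟨hmem P, ?_⟩,
    fun hG σ hσ I hI => ?_⟩
  · rw [P.entropyProductionX_eq hτ.le, ge_iff_le, add_le_add_iff_left]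
    refine P.error_sq_div_le_entropyProduction hpY hβ' hτ (Feedback.Wmin_mem hpY (hmem P)).1 ?_
    rw [P.abs_deltaI hτ.le]
    exact Feedback.Wmin_condEntropy_le hpY (P.prob_nonneg τ ⟨hτ.le, le_rfl⟩)
      (P.sum_prob ⟨hτ.le, le_rfl⟩)
  · have hI' := Ioc_subset_Icc_self hI
    have hW := Feedback.Wmin_mem hpY hI'
    have hW0 := Feedback.Wmin_pos hpY hI
    have hsum : ∀ P : Feedback.FeedbackProcess G pY β τ,
        P.IsOptimalProtocolTo (Feedback.optFinal pY σ (Feedback.Wmin pY I)) →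
        ∑ y, ∑ x, ∑ x', ∫ t in (0 : ℝ)..τ, |Feedback.current P.rate P.prob t y x x'| =
          2 * Feedback.Wmin pY I := by
      rintro P ⟨hend, ⟨π, hπ, htr⟩, -⟩
      rw [htr.sum_integral_abs_current hpY hτ.le hπ.1, hend,
        Feedback.sum_optFinal_diag hpY hW hσ, sub_sub_cancel]
    refine ⟨fun P hP => ?_, fun m hm => ?_⟩
    · have hΔ : |P.deltaI| = I := by
        rw [P.abs_deltaI hτ.le, hP.1, Feedback.condEntropy_optFinal hpY hW hσ,
          (Feedback.invOn_Wmin hpY).2 hI']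
      obtain ⟨F, hF⟩ := hP.2.2
      refine ⟨hΔ, ?_⟩
      rw [P.entropyProductionX_eq hτ.le, hΔ, hF.entropyProduction_eq hβ' hτ hW0 (hsum P hP)]
    -- The force is read off from `E = F τ⟨m⟩` with `E = Wmin pY I` and `⟨m⟩ = m`.
    · have hF : 0 < Feedback.Wmin pY I / (τ * m) := div_pos hW0 (mul_pos hτ hm)
      have hq := Feedback.optFinal_nonneg hpY hW hσ
      have hY := Feedback.sum_optFinal hpY hW hσ
      have hP := Feedback.starProcess_isOptimalProtocolTo (β := β) hG hpY.1 hq hY hτ hF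
      refine ⟨Feedback.starProcess β hG hpY.1 hq hY hτ hF, hP, ?_⟩
      have h := ((Feedback.starProcess_hasConstantUniformForce (β := β) hG hpY.1 hq hY hτ
        hF).error_eq hβ' hτ hW0 (hsum _ hP)).1
      have hne : Feedback.Wmin pY I * τ ≠ 0 := (mul_pos hW0 hτ).ne'
      rw [div_mul_eq_mul_div, eq_div_iff (mul_pos hτ hm).ne'] at h
      refine (mul_left_cancel₀ hne ?_).symm
      linarith
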